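/- We use the standard notions of computability logic. A constant game $A$ is given by a set of legal runs (finite or infinite sequences of moves, each labeled by the machine $\top$ or the environment $\bot$; a run is legal iff all its finite initial segments are) and a function assigning to each run its winner, where an illegal run is lost by the player who made the first illegal move. $A$ is static iff, whenever a run $\Gamma$ is won by a player $\wp$ and $\Delta$ is a $\wp$-delay of $\Gamma$ (each player makes the same moves in the same order in $\Delta$ as in $\Gamma$, and whenever the $n$-th move of $\wp$ comes later than the $k$-th move of its adversary in $\Gamma$, it does so in $\Delta$), then $\Delta$ is won by $\wp$. A game is a function from valuations (assignments of natural numbers to variables) to constant games, and it is static iff all its values are. $\neg$ switches the roles of the two players; $A\wedge B$ and $A\vee B$ are the parallel conjunction and disjunction (both components are played, and $\top$ has to win both, respectively at least one of them); $A\to B$ is $\neg A\vee B$. The (uncountable) branching recurrence $!A$ is played as follows. An actual node of a position is a bit string that is empty or of the form $u0$ or $u1$, where the move "$u{:}$" occurs in the position; a leaf is an actual node that is not a proper prefix of another actual node. The legal moves are the replicative moves "$w{:}$" by $\bot$, for a leaf $w$, and the moves "$w.\alpha$" by either player, for an actual node $w$, such that for every infinite bit string $v$ the move $\alpha$ is legal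 for that player in the position $\Phi^{\preceq wv}$ of $A$. Here $\Phi$ is the current position, and $\Theta^{\preceq x}$ consists of the moves $\beta$ for which $u.\beta$ occurs in $\Theta$ with $u$ an initial segment of $x$. A legal run $\Gamma$ of $!A$ is won by $\top$ iff $\Gamma^{\preceq v}$ is a $\top$-won run of $A$ for every infinite bit string $v$. A hard-play machine (HPM) is a deterministic Turing machine with a work tape, a read-only valuation tape and a read-only run tape spelling the current position; in each step it makes at most one move, while the environment can make any finite number of moves. It wins a game iff on every valuation $e$, whatever the environment does, the generated run is won by $\top$ in the value of the game at $e$. A formula is uniformly valid iff there is one HPM that wins it under every interpretation of its letters by static games. An enumeration game is a constant game in which every natural number (in decimal representation) is a legal move for either player at any time, there are no other legal moves, and the winner of a legal run depends only on the two sets of numbers that the two players have made as moves. **Theorem.** Let $P$ be a letter. The long production formula $$P\wedge\, !(P\to P\wedge P)\,\wedge\, !(P\vee P\to P)\ \to\ !P$$ is not uniformly valid. Moreover, for every HPM $\mathcal H$ and every valuation $e$ there is a static enumeration game $A$ such that, with $P$ interpreted as $A$, some run generated by $\mathcal H$ on $e$ is won by the environment. -/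

import Mathlib

namespace CoL

/-! ### Moves, players, runs -/

/-- The two players: `top` is the machine, `bot` is its environment. -/
inductive Player where
  | top
  | bot
deriving DecidableEq

/-- The adversary of a player. -/
def Player.neg : Player → Player
  | .top => .bot
  | .bot => .top

/-- The (finite) keyboard alphabet: the ten digits, the period, the colon and 83 further symbols
(so 95 symbols, as many as there are printable ASCII characters). -/
inductive Key where
  | digit (d : Fin 10)
  | dot
  | colon
  | other (k : Fin 83)
deriving DecidableEq

/-- A move is a finite string over the keyboard alphabet. -/
abbrev Move := List Key

/-- A labeled move: a move together with the player who makes it. -/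
@[ext] structure LabMove where
  player : Player
  move : Move

/-- The same move made by the other player. -/
def LabMove.neg (m : LabMove) : LabMove := ⟨m.player.neg, m.move⟩

/-- A position is a finite sequence of labeled moves. -/
abbrev Position := List LabMove

/-- A run is a finite or infinite sequence of labeled moves. -/
abbrev Run := Stream'.Seq LabMove

/-- `Φ` is a finite initial segment of the run `Γ`. -/
def Run.HasPrefix (Γ : Run) (Φ : Position) : Prop := Γ.take Φ.length = Φ

open Classical in
/-- The (finite or infinite) run that a growing sequence of positions, each one extending the
preceding ones, converges to. -/
noncomputable def Run.limit (R : ℕ → Position) : Run :=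
  ⟨fun n => if h : ∃ m k, (R k)[n]? = some m then some h.choose else none, by
    intro n hn
    by_cases h : ∃ m k, (R k)[n + 1]? = some m
    · exfalso
      obtain ⟨m, k, hk⟩ := h
      have hlt : n < (R k).length := by
        obtain ⟨hlt, -⟩ := List.getElem?_eq_some_iff.1 hk
        omega
      have h' : ∃ m k, (R k)[n]? = some m := ⟨(R k)[n], k, List.getElem?_eq_getElem hlt⟩
      simp only [dif_pos h'] at hn
      cases hn
    · exact dif_neg h⟩

/-- Apply a partial map to every labeled move of a run, deleting those where it is undefined. -/
noncomputable def Run.filterMap (f : LabMove → Option LabMove) (Γ : Run) : Run :=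
  Run.limit fun k => (Γ.take k).filterMap f

/-! ### Constant games -/

/-- A constant game. The set of legal runs is given by the set of legal positions: a run is
legal iff all of its finite initial segments are. A run that some player made illegal is lost
by that player. -/
structure ConstGame where
  /-- the legal positions -/
  Legal : Position → Prop
  legal_nil : Legal []
  legal_of_append : ∀ Φ Ψ, Legal (Φ ++ Ψ) → Legal Φ
  /-- the winner of a run -/
  Wn : Run → Player
  wn_of_illegal : ∀ (Γ : Run) (Φ : Position) (m : LabMove),
    Γ.HasPrefix (Φ ++ [m]) → Legal Φ → ¬ Legal (Φ ++ [m]) → Wn Γ = m.player.neg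

/-- A run is legal iff all its finite initial segments are legal positions. -/
def ConstGame.LegalRun (A : ConstGame) (Γ : Run) : Prop := ∀ k, A.Legal (Γ.take k)

/-- With `Legal` for the legal positions, the first illegal move of `Γ` is made by `p`. -/
def IllegalBy (Legal : Position → Prop) (p : Player) (Γ : Run) : Prop :=
  ∃ (Φ : Position) (α : Move),
    Γ.HasPrefix (Φ ++ [⟨p, α⟩]) ∧ Legal Φ ∧ ¬ Legal (Φ ++ [⟨p, α⟩])

theorem Run.HasPrefix.take_eq {Γ : Run} {Φ Ψ : Position} (hΦ : Γ.HasPrefix Φ)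
    (hΨ : Γ.HasPrefix Ψ) (h : Φ.length ≤ Ψ.length) : Ψ.take Φ.length = Φ := by
  unfold Run.HasPrefix at hΦ hΨ
  conv_rhs => rw [← hΦ]
  rw [← hΨ]
  apply List.ext_getElem?
  intro k
  rw [List.getElem?_take, Stream'.Seq.getElem?_take, Stream'.Seq.getElem?_take]
  by_cases hk : k < Φ.length
  · rw [if_pos hk, if_pos hk, if_pos (hk.trans_le h)]
  · rw [if_neg hk, if_neg hk]

theorem eq_of_illegal {Legal : Position → Prop}
    (happ : ∀ Φ Ψ, Legal (Φ ++ Ψ) → Legal Φ) {Γ : Run} {Φ Ψ : Position} {m n : LabMove}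
    (h₁ : Γ.HasPrefix (Φ ++ [m])) (h₂ : Legal Φ) (h₃ : ¬ Legal (Φ ++ [m]))
    (k₁ : Γ.HasPrefix (Ψ ++ [n])) (k₂ : Legal Ψ) (k₃ : ¬ Legal (Ψ ++ [n])) : m = n := by
  have key : ∀ {Φ Ψ : Position} {m n : LabMove}, Γ.HasPrefix (Φ ++ [m]) → ¬ Legal (Φ ++ [m]) →
      Γ.HasPrefix (Ψ ++ [n]) → Legal Ψ → ¬ Φ.length < Ψ.length := by
    intro Φ Ψ m n h₁ h₃ k₁ k₂ hlt
    have h := h₁.take_eq k₁ (by simp; omega)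
    rw [List.take_append_of_le_length (by simp; omega)] at h
    apply h₃
    rw [← h]
    apply happ _ (Ψ.drop (Φ ++ [m]).length)
    rwa [List.take_append_drop]
  have hl : Φ.length = Ψ.length := by
    have := key h₁ h₃ k₁ k₂
    have := key k₁ k₃ h₁ h₂
    omega
  have h := h₁.take_eq k₁ (by simp [hl])
  rw [List.take_of_length_le (by simp [hl])] at h
  have := (List.append_inj' h rfl).2
  simpa using this.symm

open Classical in
/-- The game with given legal positions, in which a legal run `Γ` is won by `out Γ` and an illegal
run is lost by the player who made the first illegal move. -/
noncomputable def ConstGame.ofLegal (Legal : Position → Prop) (hnil : Legal [])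
    (happ : ∀ Φ Ψ, Legal (Φ ++ Ψ) → Legal Φ) (out : Run → Player) : ConstGame where
  Legal := Legal
  legal_nil := hnil
  legal_of_append := happ
  Wn Γ :=
    if IllegalBy Legal .top Γ then .bot else if IllegalBy Legal .bot Γ then .top else out Γ
  wn_of_illegal := by
    rintro Γ Φ ⟨p, α⟩ h₁ h₂ h₃
    cases p
    · rw [if_pos ⟨Φ, α, h₁, h₂, h₃⟩]
      rfl
    · rw [if_neg, if_pos ⟨Φ, α, h₁, h₂, h₃⟩]
      · rfl
      · rintro ⟨Ψ, β, k₁, k₂, k₃⟩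
        have := eq_of_illegal happ h₁ h₂ h₃ k₁ k₂ k₃
        cases this

/-! ### Static games -/

/-- The subsequence of the moves of the run `Γ` made by `p`. -/
noncomputable def Run.movesOf (p : Player) (Γ : Run) : Run :=
  Γ.filterMap fun m => if m.player = p then some m else none

/-- The `n`-th move (counting from 0) of the player `p` in `Γ` is the `i`-th labeled move
of `Γ`. -/
def Run.IsNthMoveOf (Γ : Run) (p : Player) (n i : ℕ) : Prop :=
  (∃ α, Γ.get? i = some ⟨p, α⟩) ∧ (Γ.take i).countP (fun m => m.player = p) = n

/-- `Δ` is a `p`-delay of `Γ`: each player makes the same moves in the same order in both runs,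
and if the `n`-th move of `p` comes later than the `k`-th move of its adversary in `Γ`,
then so it does in `Δ`. -/
def IsDelay (p : Player) (Γ Δ : Run) : Prop :=
  (∀ q, Γ.movesOf q = Δ.movesOf q) ∧
  ∀ n k i j, Γ.IsNthMoveOf p n i → Γ.IsNthMoveOf p.neg k j → j < i →
    ∀ i' j', Δ.IsNthMoveOf p n i' → Δ.IsNthMoveOf p.neg k j' → j' < i'

/-- A static game: delaying its own moves never turns a win of a player into a loss. -/
def ConstGame.Static (A : ConstGame) : Prop :=
  ∀ (p : Player) (Γ Δ : Run), IsDelay p Γ Δ → A.Wn Γ = p → A.Wn Δ = p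

/-! ### Game operations -/

/-- Negation: the two players switch roles. -/
noncomputable def ConstGame.neg (A : ConstGame) : ConstGame :=
  .ofLegal (fun Φ => A.Legal (Φ.map LabMove.neg)) A.legal_nil
    (fun Φ Ψ h => A.legal_of_append _ (Ψ.map LabMove.neg) (by simpa using h))
    (fun Γ => (A.Wn (Γ.map LabMove.neg)).neg)

/-- Delete the prefix `pre` from a labeled move; undefined if the move does not start with it. -/
def LabMove.strip (pre : Move) (m : LabMove) : Option LabMove :=
  if pre <+: m.move then some ⟨m.player, m.move.drop pre.length⟩ else none

/-- The prefix `0.` of the moves in the left component of a parallel combination. -/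
def leftTag : Move := [.digit 0, .dot]

/-- The prefix `1.` of the moves in the right component of a parallel combination. -/
def rightTag : Move := [.digit 1, .dot]

/-- Legal positions of both parallel conjunction and parallel disjunction. -/
def ParLegal (A B : ConstGame) (Φ : Position) : Prop :=
  (∀ m ∈ Φ, leftTag <+: m.move ∨ rightTag <+: m.move) ∧
    A.Legal (Φ.filterMap (LabMove.strip leftTag)) ∧
    B.Legal (Φ.filterMap (LabMove.strip rightTag))

theorem parLegal_nil (A B : ConstGame) : ParLegal A B [] :=
  ⟨by simp, A.legal_nil, B.legal_nil⟩

theorem parLegal_of_append (A B : ConstGame) (Φ Ψ : Position) (h : ParLegal A B (Φ ++ Ψ)) :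
    ParLegal A B Φ := by
  obtain ⟨h₁, h₂, h₃⟩ := h
  rw [List.filterMap_append] at h₂ h₃
  exact ⟨fun m hm => h₁ m (List.mem_append_left _ hm), A.legal_of_append _ _ h₂,
    B.legal_of_append _ _ h₃⟩

open Classical in
/-- Parallel conjunction: both games are played, and the machine has to win both. -/
noncomputable def ConstGame.conj (A B : ConstGame) : ConstGame :=
  .ofLegal (ParLegal A B) (parLegal_nil A B) (parLegal_of_append A B) fun Γ =>
    if A.Wn (Γ.filterMap (LabMove.strip leftTag)) = .top ∧
      B.Wn (Γ.filterMap (LabMove.strip rightTag)) = .top then .top else .bot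

open Classical in
/-- Parallel disjunction: both games are played, and the machine has to win one of them. -/
noncomputable def ConstGame.disj (A B : ConstGame) : ConstGame :=
  .ofLegal (ParLegal A B) (parLegal_nil A B) (parLegal_of_append A B) fun Γ =>
    if A.Wn (Γ.filterMap (LabMove.strip leftTag)) = .top ∨
      B.Wn (Γ.filterMap (LabMove.strip rightTag)) = .top then .top else .bot

/-- A finite bit string as a string over the keyboard alphabet. -/
def bits (w : List Bool) : Move := w.map fun b => .digit (if b then 1 else 0)

/-- The bit string `w` is an actual node of the position `Φ` of a branching recurrence: it is
empty, or else `u0` or `u1` for some `u` such that `Φ` contains the replicative move `u:`. -/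
def IsActualNode (Φ : Position) (w : List Bool) : Prop :=
  w = [] ∨ ∃ (u : List Bool) (b : Bool), w = u ++ [b] ∧ ∃ m ∈ Φ, m.move = bits u ++ [.colon]

/-- A leaf is an actual node that is not a proper prefix of any other actual node. -/
def IsLeaf (Φ : Position) (w : List Bool) : Prop :=
  IsActualNode Φ w ∧ ∀ w', IsActualNode Φ w' → w <+: w' → w' = w

open Classical in
/-- For an infinite bit string `x`: turn a move `u.β`, where `u` is an initial segment of `x`,
into `β`; undefined on all other moves. -/
noncomputable def LabMove.stripThread (x : Stream' Bool) (m : LabMove) : Option LabMove :=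
  if ∃ n : ℕ, bits (x.take n) ++ [.dot] <+: m.move then
    some ⟨m.player, (m.move.dropWhile (fun c => c ≠ .dot)).drop 1⟩
  else none

/-- The labeled move `m` is legal in position `Φ` of the branching recurrence of `A`: it is
either a replicative move `w:` of the environment, with `w` a leaf, or a non-replicative move `w.α`
of either player, with `w` an actual node and `α` legal for that player in all threads
through `w`. -/
def BrecLegalMove (A : ConstGame) (Φ : Position) (m : LabMove) : Prop :=
  (m.player = .bot ∧ ∃ w, IsLeaf Φ w ∧ m.move = bits w ++ [.colon]) ∨
  ∃ (w : List Bool) (α : Move), IsActualNode Φ w ∧ m.move = bits w ++ .dot :: α ∧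
    ∀ v : Stream' Bool,
      A.Legal (Φ.filterMap (LabMove.stripThread (w ++ₛ v)) ++ [⟨m.player, α⟩])

open Classical in
/-- (Uncountable) branching recurrence: the environment may split any thread at any time, and the
machine has to win `A` in the thread of every infinite bit string. -/
noncomputable def ConstGame.brec (A : ConstGame) : ConstGame :=
  .ofLegal (fun Φ => ∀ (Ψ : Position) (m : LabMove), Ψ ++ [m] <+: Φ → BrecLegalMove A Ψ m)
    (by
      intro Ψ m h
      simp at h)
    (fun Φ Φ' h Ψ m hΨ => h Ψ m (hΨ.trans (List.prefix_append _ _)))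
    fun Γ =>
      if ∀ v : Stream' Bool, A.Wn (Γ.filterMap (LabMove.stripThread v)) = .top
      then .top else .bot

/-! ### Games, formulas, interpretations -/

/-- A valuation assigns a constant (a natural number) to each of the variables
`v₀, v₁, v₂, …`. -/
abbrev Valuation := ℕ → ℕ

/-- A (not necessarily constant) game: a function from valuations to constant games. -/
abbrev Game := Valuation → ConstGame

/-- A game is static iff all its instances are. -/
def Game.Static (A : Game) : Prop := ∀ e, (A e).Static

/-- Formulas built from 0-ary general letters by negation, parallel conjunction, parallel
disjunction and branching recurrence. -/
inductive Formula where
  | letter (n : ℕ)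
  | neg (F : Formula)
  | conj (F G : Formula)
  | disj (F G : Formula)
  | brec (F : Formula)

/-- Implication `F → G` abbreviates `¬F ∨ G`. -/
def Formula.imp (F G : Formula) : Formula := .disj (.neg F) G

/-- The game into which a formula turns when the letters are interpreted by games. -/
noncomputable def Formula.interp (I : ℕ → Game) : Formula → Game
  | .letter n => I n
  | .neg F => fun e => (F.interp I e).neg
  | .conj F G => fun e => (F.interp I e).conj (G.interp I e)
  | .disj F G => fun e => (F.interp I e).disj (G.interp I e)
  | .brec F => fun e => (F.interp I e).brec

/-- An interpretation sends each letter to a static game. -/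
structure Interpretation where
  game : ℕ → Game
  static : ∀ n, (game n).Static

/-- Long production: `P ∧ !(P → P ∧ P) ∧ !(P ∨ P → P) → !P`, with branching recurrence as `!`. -/
def Formula.longProduction (P : Formula) : Formula :=
  .imp (.conj (.conj P (.brec (.imp P (.conj P P)))) (.brec (.imp (.disj P P) P))) (.brec P)

/-! ### Hard-play machines -/

/-- The decimal representation of a natural number. -/
def decimal (n : ℕ) : Move :=
  if n = 0 then [.digit 0] else (Nat.digits 10 n).reverse.map fun d => .digit (Fin.ofNat 10 d)

/-- Directions in which a head may move. -/
inductive Dir where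
  | left
  | stay
  | right

/-- New head position; at the leftmost cell of a tape a head does not move to the left. -/
def Dir.apply : Dir → ℕ → ℕ
  | .left, i => i - 1
  | .stay, i => i
  | .right, i => i + 1

/-- Symbols on the run tape: the labels of the two players and the keyboard symbols. -/
inductive RunSym where
  | label (p : Player)
  | key (k : Key)

/-- The content of the run tape (`none` is the blank): the current position spelled out. -/
def runTape (Φ : Position) (i : ℕ) : Option RunSym :=
  (Φ.flatMap fun m => .label m.player :: m.move.map .key)[i]?

/-- The content of the valuation tape: the constants `e 0, e 1, e 2, …` in decimal notation, each
followed by a separator (`none`). -/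
def valuationTape (e : Valuation) (i : ℕ) : Option Key :=
  ((List.range (i + 1)).flatMap fun j => (decimal (e j)).map some ++ [none]).getD i none

/-- A hard-play machine: a deterministic Turing machine with a read/write work tape, a read-only
valuation tape and a read-only run tape, some of whose finitely many states are move states. The
work tape alphabet has the keyboard symbols, finitely many auxiliary symbols, and the blank
(`none`). From the state and the three scanned symbols, `step` determines the next state,
the symbol to write on the work tape, and how the work, valuation and run heads move. -/
structure HPM where
  State : Type
  finite_state : Finite State
  start : State
  moveStates : Set State
  Aux : Type
  finite_aux : Finite Aux
  step : State → Option (Key ⊕ Aux) → Option Key → Option RunSym →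
    State × Option (Key ⊕ Aux) × Dir × Dir × Dir

/-- A configuration of a hard-play machine. The run tape is represented by the position that it
spells. -/
structure HPM.Config (H : HPM) where
  state : H.State
  work : ℕ → Option (Key ⊕ H.Aux)
  workHead : ℕ
  valuationHead : ℕ
  runHead : ℕ
  position : Position

/-- The initial configuration: start state, blank work and run tapes, heads at the left ends. -/
def HPM.init (H : HPM) : H.Config := ⟨H.start, fun _ => none, 0, 0, 0, []⟩

/-- The move spelled on the work tape to the left of the scanned cell. -/
def HPM.Config.output {H : HPM} (C : H.Config) : Move :=
  (List.range C.workHead).filterMap fun i =>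
    match C.work i with
    | some (.inl k) => some k
    | _ => none

open Classical in
/-- The labeled move (if any) that the machine makes in a configuration. -/
noncomputable def HPM.Config.machineMove {H : HPM} (C : H.Config) : Position :=
  if C.state ∈ H.moveStates then [⟨.top, C.output⟩] else []

/-- The next configuration, if `Ψ` is the finite sequence of moves that the environment makes
during this step. The machine makes at most one move. -/
noncomputable def HPM.next (H : HPM) (e : Valuation) (C : H.Config) (Ψ : List Move) : H.Config :=
  let a := H.step C.state (C.work C.workHead) (valuationTape e C.valuationHead)
    (runTape C.position C.runHead)
  { state := a.1
    work := Function.update C.work C.workHead a.2.1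
    workHead := a.2.2.1.apply C.workHead
    valuationHead := a.2.2.2.1.apply C.valuationHead
    runHead := a.2.2.2.2.apply C.runHead
    position := C.position ++ C.machineMove ++ Ψ.map fun α => ⟨.bot, α⟩ }

/-- `C` is a computation branch of `H` on valuation `e`, for some behavior of the environment. -/
def HPM.IsBranch (H : HPM) (e : Valuation) (C : ℕ → H.Config) : Prop :=
  C 0 = H.init ∧ ∀ i, ∃ Ψ : List Move, C (i + 1) = H.next e (C i) Ψ

/-- `Γ` is a run generated by `H` on valuation `e`: the run spelled by a computation branch. -/
def HPM.Generates (H : HPM) (e : Valuation) (Γ : Run) : Prop :=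
  ∃ C : ℕ → H.Config, H.IsBranch e C ∧ Γ = Run.limit fun i => (C i).position

/-- `H` wins the game `A`: whatever the valuation and the behavior of the environment are, the
generated run is won by the machine. -/
def HPM.Wins (H : HPM) (A : Game) : Prop :=
  ∀ (e : Valuation) (Γ : Run), H.Generates e Γ → (A e).Wn Γ = .top

/-- Uniform validity: a single machine wins the formula under every interpretation. -/
def UniformlyValid (F : Formula) : Prop :=
  ∃ H : HPM, ∀ I : Interpretation, H.Wins (F.interp I.game)

/-! ### Enumeration games -/

/-- The set of the numbers enumerated by the player `p` in the run `Γ`. -/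
def Run.enumerated (Γ : Run) (p : Player) : Set ℕ :=
  {n | ∃ i, Γ.get? i = some ⟨p, decimal n⟩}

/-- An enumeration game: the legal moves of either player at any time are exactly the natural
numbers in decimal representation, and the winner of a legal run depends only on the two sets
of numbers enumerated by the two players. -/
def ConstGame.IsEnumeration (A : ConstGame) : Prop :=
  (∀ Φ : Position, A.Legal Φ ↔ ∀ m ∈ Φ, ∃ n, m.move = decimal n) ∧
  ∀ Γ Δ : Run, A.LegalRun Γ → A.LegalRun Δ →
    (∀ p, Γ.enumerated p = Δ.enumerated p) → A.Wn Γ = A.Wn Δ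

end CoL

namespace CoL

/-! ### Runs as limits of positions -/

/-! Legality in an enumeration game does not depend on who wins it. So the environment can complete
a run first, and the set `T` of values (pairs of enumerated sets) won by the machine in `enumGame T`
can be chosen afterwards, by looking at that run.

The environment splits every node of the succedent `!A`, and in each recurrence it marks every
actual node `w` by enumerating a code of `w`: in the threads of `!A`, in the antecedent of `A → A ∧
A`, and in both disjuncts of `A ∨ A`. A fair schedule carries this out against any machine
(`exists_persistent_run`), unless the machine makes the first illegal move and loses at once.

In the succedent the marks make the values in different threads different
(`Run.IsPersistent.targetThread_value_injective`), so uncountably many values occur there. In the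
antecedent the marks in an input reveal through which actual nodes its thread passes, and hence the
entire play in that thread (`filterMap_stripThread_eq`). An input value therefore determines the
corresponding output values, at most four of them (`ValueStep`), and the closure `reachable Γ` of
the value of the conjunct `A` under these steps is countable.

Let `T` be this closure. The environment wins the antecedent (`Run.IsPersistent.resource_wn`): the
base value is in `T`, and `T` is closed under passing from inputs to outputs. Yet some thread of the
succedent has a value outside `T` (`Run.IsPersistent.exists_value_notMem`), so the machine loses
there too. The game is static because delays preserve the enumerated sets (`static_enumGame`). -/

/-- The labeled move `m` occurs in the run `Γ`. -/
def Run.Has (Γ : Run) (m : LabMove) : Prop := ∃ i, Γ.get? i = some m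

theorem Run.mem_take {Γ : Run} {k : ℕ} {m : LabMove} :
    m ∈ Γ.take k ↔ ∃ i < k, Γ.get? i = some m := by
  rw [List.mem_iff_getElem?]
  simp only [Stream'.Seq.getElem?_take]
  constructor
  · rintro ⟨i, hi⟩
    split_ifs at hi with h
    exact ⟨i, h, hi⟩
  · rintro ⟨i, h, hi⟩
    exact ⟨i, by rw [if_pos h, hi]⟩

theorem Run.has_iff_mem_take {Γ : Run} {m : LabMove} : Γ.Has m ↔ ∃ k, m ∈ Γ.take k := by
  simp only [Run.mem_take]
  exact ⟨fun ⟨i, hi⟩ => ⟨i + 1, i, by omega, hi⟩, fun ⟨_, i, _, hi⟩ => ⟨i, hi⟩⟩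

theorem Run.take_prefix_take (Γ : Run) {i j : ℕ} (h : i ≤ j) : Γ.take i <+: Γ.take j := by
  have : (Γ.take j).take i = Γ.take i := by
    apply List.ext_getElem?
    intro k
    rw [List.getElem?_take, Stream'.Seq.getElem?_take, Stream'.Seq.getElem?_take]
    by_cases hk : k < i
    · rw [if_pos hk, if_pos hk, if_pos (hk.trans_le h)]
    · rw [if_neg hk, if_neg hk]
  rw [← this]
  exact List.take_prefix _ _

/-- The point to exclude is that `Γ` is finite and `take` returns less than was asked for. It
cannot, because `Φ` still has an entry at the place where `Γ` would have ended. -/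
theorem Run.HasPrefix.of_prefix {Γ : Run} {Φ Ψ : Position} (h : Γ.HasPrefix Φ)
    (hΨ : Ψ <+: Φ) : Γ.HasPrefix Ψ := by
  have h₁ : Γ.take Ψ.length <+: Γ.take Φ.length := Γ.take_prefix_take hΨ.length_le
  unfold Run.HasPrefix at h ⊢
  rw [h] at h₁
  have h₂ := List.prefix_of_prefix_length_le h₁ hΨ (Stream'.Seq.length_take_le)
  obtain ⟨t, ht⟩ := h₂
  by_contra hne
  have hlt : (Γ.take Ψ.length).length < Ψ.length := by
    rcases t with _ | ⟨a, t⟩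
    · exact absurd (by simpa using ht) hne
    · have := congrArg List.length ht
      simp only [List.length_append, List.length_cons] at this
      omega
  have h₃ : (Γ.take Φ.length)[(Γ.take Ψ.length).length]? = none := by
    rw [Stream'.Seq.getElem?_take, if_pos (hlt.trans_le hΨ.length_le)]
    have := List.getElem?_eq_none (l := Γ.take Ψ.length) (le_refl _)
    rwa [Stream'.Seq.getElem?_take, if_pos hlt] at this
  rw [h, List.getElem?_eq_none_iff] at h₃
  have := hΨ.length_le
  omega

/-- A sequence of positions, each one extending the preceding ones. -/
def IsGrowing (R : ℕ → Position) : Prop := ∀ i j, i ≤ j → R i <+: R j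

theorem isGrowing_of_succ {R : ℕ → Position} (h : ∀ i, R i <+: R (i + 1)) : IsGrowing R := by
  intro i j hij
  induction j, hij using Nat.le_induction with
  | base => exact List.prefix_rfl
  | succ j _ ih => exact ih.trans (h j)

/-- Growing stages agree wherever they are defined, so the choice made in `Run.limit` has only one
possible outcome. -/
theorem Run.get?_limit {R : ℕ → Position} (hR : IsGrowing R) {n : ℕ} {m : LabMove} :
    (Run.limit R).get? n = some m ↔ ∃ k, (R k)[n]? = some m := by
  classical
  have huniq : ∀ {m m' : LabMove} {k k' : ℕ}, (R k)[n]? = some m → (R k')[n]? = some m' →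
      m = m' := by
    intro m m' k k' h h'
    have hext : ∀ {i j : ℕ} {m : LabMove}, i ≤ j → (R i)[n]? = some m → (R j)[n]? = some m := by
      intro i j m hij hi
      obtain ⟨t, ht⟩ := hR i j hij
      rw [← ht, List.getElem?_append_left (List.getElem?_eq_some_iff.1 hi).1, hi]
    have h₁ := hext (le_max_left k k') h
    have h₂ := hext (le_max_right k k') h'
    exact Option.some.inj (h₁.symm.trans h₂)
  have hdef : (Run.limit R).get? n =
      if h : ∃ m k, (R k)[n]? = some m then some h.choose else none := rfl
  rw [hdef]
  constructor
  · intro h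
    split_ifs at h with hex
    rw [← Option.some.inj h]
    exact hex.choose_spec
  · rintro ⟨k, hk⟩
    have hex : ∃ m k, (R k)[n]? = some m := ⟨m, k, hk⟩
    rw [dif_pos hex]
    obtain ⟨k', hk'⟩ := hex.choose_spec
    rw [huniq hk' hk]

theorem Run.hasPrefix_limit {R : ℕ → Position} (hR : IsGrowing R) (j : ℕ) :
    (Run.limit R).HasPrefix (R j) := by
  apply List.ext_getElem?
  intro i
  rw [Stream'.Seq.getElem?_take]
  split_ifs with h
  · rw [List.getElem?_eq_getElem h, Run.get?_limit hR]
    exact ⟨j, List.getElem?_eq_getElem h⟩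
  · rw [List.getElem?_eq_none (by omega)]

/-- This transfers prefix-closed properties, legality above all, from the stages to the limit. -/
theorem Run.take_limit_prefix {R : ℕ → Position} (hR : IsGrowing R) (k : ℕ) :
    ∃ j, (Run.limit R).take k <+: R j := by
  induction k with
  | zero => exact ⟨0, by simp⟩
  | succ k ih =>
    cases hk : (Run.limit R).get? k with
    | none =>
      obtain ⟨j, hj⟩ := ih
      refine ⟨j, ?_⟩
      have : (Run.limit R).take (k + 1) = (Run.limit R).take k := by
        apply List.ext_getElem?
        intro i
        rw [Stream'.Seq.getElem?_take, Stream'.Seq.getElem?_take]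
        rcases lt_trichotomy i k with h | h | h
        · rw [if_pos h, if_pos (by omega)]
        · subst h; simp [hk]
        · rw [if_neg (by omega), if_neg (by omega)]
      rwa [this]
    | some m =>
      obtain ⟨j, hj⟩ := (Run.get?_limit hR).1 hk
      obtain ⟨hlt, -⟩ := List.getElem?_eq_some_iff.1 hj
      refine ⟨j, ?_⟩
      have h := Run.take_prefix_take (Run.limit R) (i := k + 1) (j := (R j).length) hlt
      rwa [Run.hasPrefix_limit hR j] at h

theorem Run.has_limit {R : ℕ → Position} (hR : IsGrowing R) {m : LabMove} :
    (Run.limit R).Has m ↔ ∃ k, m ∈ R k := by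
  simp only [Run.Has, Run.get?_limit hR, List.mem_iff_getElem?]
  exact exists_comm

theorem isGrowing_filterMap_take (f : LabMove → Option LabMove) (Γ : Run) :
    IsGrowing fun k => (Γ.take k).filterMap f :=
  fun _ _ hij => (Γ.take_prefix_take hij).filterMap f

theorem Run.has_filterMap {f : LabMove → Option LabMove} {Γ : Run} {m : LabMove} :
    (Γ.filterMap f).Has m ↔ ∃ m', Γ.Has m' ∧ f m' = some m := by
  rw [Run.filterMap, Run.has_limit (isGrowing_filterMap_take f Γ)]
  simp only [List.mem_filterMap, Run.has_iff_mem_take]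
  exact ⟨fun ⟨k, m', h, h'⟩ => ⟨m', ⟨k, h⟩, h'⟩, fun ⟨m', ⟨k, h⟩, h'⟩ => ⟨k, m', h, h'⟩⟩

theorem Run.take_filterMap_prefix (f : LabMove → Option LabMove) (Γ : Run) (k : ℕ) :
    ∃ j, (Γ.filterMap f).take k <+: (Γ.take j).filterMap f :=
  Run.take_limit_prefix (isGrowing_filterMap_take f Γ) k

theorem Run.filterMap_congr {f g : LabMove → Option LabMove} {Γ : Run}
    (h : ∀ m, Γ.Has m → f m = g m) : Γ.filterMap f = Γ.filterMap g := by
  unfold Run.filterMap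
  congr 1
  funext k
  exact List.filterMap_congr fun m hm => h m (Run.has_iff_mem_take.2 ⟨k, hm⟩)

theorem Run.take_map (g : LabMove → LabMove) (Γ : Run) (k : ℕ) :
    Stream'.Seq.take k (Γ.map g) = (Γ.take k).map g := by
  apply List.ext_getElem?
  intro i
  rw [Stream'.Seq.getElem?_take, List.getElem?_map, Stream'.Seq.getElem?_take,
    Stream'.Seq.map_get?]
  split_ifs <;> rfl

/-! ### Moves and their prefixes -/

theorem Player.neg_neg (p : Player) : p.neg.neg = p := by cases p <;> rfl

theorem LabMove.neg_neg (m : LabMove) : m.neg.neg = m := by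
  simp [LabMove.neg, Player.neg_neg]

theorem Run.has_map_neg {Γ : Run} {m : LabMove} :
    Run.Has (Γ.map LabMove.neg) m ↔ Γ.Has m.neg := by
  simp only [Run.Has, Stream'.Seq.map_get?, Option.map_eq_some_iff]
  constructor
  · rintro ⟨i, m', h, rfl⟩
    exact ⟨i, by rw [h, LabMove.neg_neg]⟩
  · rintro ⟨i, h⟩
    exact ⟨i, _, h, LabMove.neg_neg m⟩

theorem mem_map_neg {Φ : Position} {m : LabMove} : m ∈ Φ.map LabMove.neg ↔ m.neg ∈ Φ := by
  rw [List.mem_map]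
  exact ⟨fun ⟨a, h, h'⟩ => by rwa [← h', LabMove.neg_neg], fun h => ⟨_, h, LabMove.neg_neg m⟩⟩

theorem LabMove.strip_eq_some {pre : Move} {m m' : LabMove} :
    m.strip pre = some m' ↔ m = ⟨m'.player, pre ++ m'.move⟩ := by
  unfold LabMove.strip
  constructor
  · intro h
    split_ifs at h with hp
    obtain ⟨t, ht⟩ := hp
    rw [← Option.some.inj h]
    ext1
    · rfl
    · simp [← ht]
  · rintro rfl
    simp

theorem Run.has_filterMap_strip {pre : Move} {Γ : Run} {m : LabMove} :
    (Γ.filterMap (LabMove.strip pre)).Has m ↔ Γ.Has ⟨m.player, pre ++ m.move⟩ := by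
  simp [Run.has_filterMap, LabMove.strip_eq_some]

theorem mem_filterMap_strip {pre : Move} {Φ : Position} {m : LabMove} :
    m ∈ Φ.filterMap (LabMove.strip pre) ↔ (⟨m.player, pre ++ m.move⟩ : LabMove) ∈ Φ := by
  simp [List.mem_filterMap, LabMove.strip_eq_some]

theorem digit_ite_injective :
    Function.Injective fun b : Bool => Key.digit (if b then 1 else 0) := by
  intro a b h
  cases a <;> cases b <;> simp_all

theorem bits_injective : Function.Injective bits :=
  List.map_injective_iff.2 digit_ite_injective

theorem dot_notMem_bits (w : List Bool) : Key.dot ∉ bits w := by simp [bits]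

theorem append_cons_inj_of_notMem {α : Type*} {a : α} {l₁ l₂ r₁ r₂ : List α} (h₁ : a ∉ l₁)
    (h₂ : a ∉ l₂) (h : l₁ ++ a :: r₁ = l₂ ++ a :: r₂) : l₁ = l₂ ∧ r₁ = r₂ := by
  induction l₁ generalizing l₂ with
  | nil =>
    cases l₂ with
    | nil => simpa using h
    | cons b l₂ => simp_all
  | cons b l₁ ih =>
    cases l₂ with
    | nil =>
      rw [List.cons_append, List.nil_append, List.cons.injEq] at h
      exact absurd (h.1 ▸ List.mem_cons_self) h₁
    | cons c l₂ =>
      simp only [List.cons_append, List.cons.injEq, List.mem_cons, not_or] at h h₁ h₂ ⊢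
      obtain ⟨rfl, h⟩ := h
      have := ih h₁.2 h₂.2 h
      exact ⟨⟨rfl, this.1⟩, this.2⟩

/-- A bit string contains no period, so the first period of a move shows where its node ends,
whatever follows. -/
theorem bits_append_dot_inj {u w : List Bool} {α β : Move}
    (h : bits u ++ .dot :: α = bits w ++ .dot :: β) : u = w ∧ α = β := by
  obtain ⟨h₁, h₂⟩ := append_cons_inj_of_notMem (dot_notMem_bits u) (dot_notMem_bits w) h
  exact ⟨bits_injective h₁, h₂⟩

theorem bits_append_colon_inj {u w : List Bool}
    (h : bits u ++ [Key.colon] = bits w ++ [.colon]) : u = w :=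
  bits_injective (List.append_left_injective _ h)

theorem bits_append_dot_ne_colon {u w : List Bool} {α : Move} :
    bits u ++ .dot :: α ≠ bits w ++ [.colon] := by
  intro h
  have : Key.dot ∈ bits w ++ [Key.colon] := by rw [← h]; simp
  simp [dot_notMem_bits] at this

theorem LabMove.stripThread_eq_some {x : Stream' Bool} {m m' : LabMove} :
    m.stripThread x = some m' ↔
      ∃ n : ℕ, m = ⟨m'.player, bits (x.take n) ++ .dot :: m'.move⟩ := by
  have key : ∀ (n : ℕ) (α : Move),
      ((bits (x.take n) ++ .dot :: α).dropWhile (fun c => c ≠ .dot)).drop 1 = α := by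
    intro n α
    rw [List.dropWhile_append_of_pos]
    · simp
    · intro a ha
      have : a ≠ .dot := by rintro rfl; exact dot_notMem_bits _ ha
      simpa using this
  unfold LabMove.stripThread
  constructor
  · intro h
    split_ifs at h with hp
    obtain ⟨n, t, ht⟩ := hp
    rw [List.append_assoc, List.singleton_append] at ht
    rw [← Option.some.inj h]
    refine ⟨n, ?_⟩
    ext1
    · rfl
    · simp only
      rw [← ht, key]
  · rintro ⟨n, rfl⟩
    rw [if_pos ⟨n, m'.move, List.append_assoc _ _ _⟩, key]

theorem Run.has_filterMap_stripThread {x : Stream' Bool} {Γ : Run} {m : LabMove} :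
    (Γ.filterMap (LabMove.stripThread x)).Has m ↔
      ∃ n : ℕ, Γ.Has ⟨m.player, bits (x.take n) ++ .dot :: m.move⟩ := by
  simp only [Run.has_filterMap, LabMove.stripThread_eq_some]
  exact ⟨fun ⟨_, h, n, h'⟩ => ⟨n, h' ▸ h⟩, fun ⟨n, h⟩ => ⟨_, h, n, rfl⟩⟩

/-- The number is recovered by `Nat.ofDigits`. Zero needs separate care: `Nat.digits 10 0` is empty,
while `decimal 0` is the single digit 0. -/
theorem decimal_injective : Function.Injective decimal := by
  have hpos : ∀ {n : ℕ}, n ≠ 0 →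
      decimal n = (Nat.digits 10 n).reverse.map fun d => .digit (Fin.ofNat 10 d) :=
    fun h => if_neg h
  have hdig : ∀ n : ℕ, ((decimal n).reverse.map fun
      | .digit d => (d : ℕ)
      | _ => 0) = if n = 0 then [0] else Nat.digits 10 n := by
    intro n
    split_ifs with hn
    · subst hn; simp [decimal]
    · rw [hpos hn, ← List.map_reverse, List.reverse_reverse, List.map_map]
      conv_rhs => rw [← List.map_id (Nat.digits 10 n)]
      apply List.map_congr_left
      intro d hd
      simp [Fin.ofNat, Nat.mod_eq_of_lt (Nat.digits_lt_base (by norm_num) hd)]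
  intro a b h
  have h' := congrArg (fun l => Nat.ofDigits 10 ((l : Move).reverse.map fun
      | .digit d => (d : ℕ)
      | _ => 0)) h
  simp only [hdig] at h'
  have hval : ∀ n : ℕ, Nat.ofDigits 10 (if n = 0 then [0] else Nat.digits 10 n) = n := by
    intro n
    split_ifs with hn
    · simp [hn]
    · exact Nat.ofDigits_digits 10 n
  rwa [hval, hval] at h'

/-! ### Winners and legality in compound games -/

theorem ConstGame.LegalRun.of_hasPrefix {A : ConstGame} {Γ : Run} (h : A.LegalRun Γ)
    {Φ : Position} (hΦ : Γ.HasPrefix Φ) : A.Legal Φ := by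
  have := h Φ.length
  rwa [hΦ] at this

theorem ConstGame.legal_of_prefix (A : ConstGame) {Φ Ψ : Position} (h : Φ <+: Ψ)
    (hΨ : A.Legal Ψ) : A.Legal Φ := by
  obtain ⟨t, rfl⟩ := h
  exact A.legal_of_append _ _ hΨ

theorem ConstGame.LegalRun.not_illegalBy {A : ConstGame} {Γ : Run} (h : A.LegalRun Γ)
    (p : Player) : ¬ IllegalBy A.Legal p Γ :=
  fun ⟨_, _, h₁, _, h₃⟩ => h₃ (h.of_hasPrefix h₁)

theorem ConstGame.ofLegal_wn {Legal : Position → Prop} {hnil : Legal []}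
    {happ : ∀ Φ Ψ, Legal (Φ ++ Ψ) → Legal Φ} {out : Run → Player} {Γ : Run}
    (h : (ConstGame.ofLegal Legal hnil happ out).LegalRun Γ) :
    (ConstGame.ofLegal Legal hnil happ out).Wn Γ = out Γ := by
  have h₁ : ¬ IllegalBy Legal .top Γ := h.not_illegalBy .top
  have h₂ : ¬ IllegalBy Legal .bot Γ := h.not_illegalBy .bot
  simp only [ConstGame.ofLegal, if_neg h₁, if_neg h₂]

theorem ite_top_eq_top {c : Prop} [Decidable c] :
    (if c then Player.top else Player.bot) = .top ↔ c := by
  split_ifs with h <;> simp [h]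

theorem Player.ne_top {p : Player} : p ≠ .top ↔ p = .bot := by cases p <;> simp

theorem ConstGame.neg_wn {A : ConstGame} {Γ : Run} (h : A.neg.LegalRun Γ) :
    A.neg.Wn Γ = (A.Wn (Γ.map LabMove.neg)).neg :=
  ConstGame.ofLegal_wn h

theorem ConstGame.neg_wn_eq_top {A : ConstGame} {Γ : Run} (h : A.neg.LegalRun Γ) :
    A.neg.Wn Γ = .top ↔ A.Wn (Γ.map LabMove.neg) ≠ .top := by
  rw [ConstGame.neg_wn h]
  cases A.Wn (Γ.map LabMove.neg) <;> simp [Player.neg]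

theorem ConstGame.conj_wn_eq_top {A B : ConstGame} {Γ : Run} (h : (A.conj B).LegalRun Γ) :
    (A.conj B).Wn Γ = .top ↔ A.Wn (Γ.filterMap (LabMove.strip leftTag)) = .top ∧
      B.Wn (Γ.filterMap (LabMove.strip rightTag)) = .top :=
  (ConstGame.ofLegal_wn h).congr_left.trans ite_top_eq_top

theorem ConstGame.disj_wn_eq_top {A B : ConstGame} {Γ : Run} (h : (A.disj B).LegalRun Γ) :
    (A.disj B).Wn Γ = .top ↔ A.Wn (Γ.filterMap (LabMove.strip leftTag)) = .top ∨
      B.Wn (Γ.filterMap (LabMove.strip rightTag)) = .top :=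
  (ConstGame.ofLegal_wn h).congr_left.trans ite_top_eq_top

open Classical in
theorem ConstGame.brec_wn_eq_top {A : ConstGame} {Γ : Run} (h : A.brec.LegalRun Γ) :
    A.brec.Wn Γ = .top ↔
      ∀ v : Stream' Bool, A.Wn (Γ.filterMap (LabMove.stripThread v)) = .top :=
  (ConstGame.ofLegal_wn h).congr_left.trans ite_top_eq_top

/-- Every finite piece of the filtered run lies inside a filtered finite piece of `Γ`, so it
suffices to control positions. -/
theorem ConstGame.LegalRun.filterMap {A B : ConstGame} {Γ : Run} {f : LabMove → Option LabMove}
    (h : A.LegalRun Γ) (hf : ∀ Φ, A.Legal Φ → B.Legal (Φ.filterMap f)) :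
    B.LegalRun (Γ.filterMap f) := by
  intro k
  obtain ⟨j, hj⟩ := Run.take_filterMap_prefix f Γ k
  exact B.legal_of_prefix hj (hf _ (h j))

theorem ConstGame.LegalRun.neg {A : ConstGame} {Γ : Run} (h : A.neg.LegalRun Γ) :
    A.LegalRun (Γ.map LabMove.neg) := by
  intro k
  rw [Run.take_map]
  exact h k

theorem ConstGame.LegalRun.conj_left {A B : ConstGame} {Γ : Run} (h : (A.conj B).LegalRun Γ) :
    A.LegalRun (Γ.filterMap (LabMove.strip leftTag)) :=
  h.filterMap fun _ hΦ => hΦ.2.1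

theorem ConstGame.LegalRun.conj_right {A B : ConstGame} {Γ : Run} (h : (A.conj B).LegalRun Γ) :
    B.LegalRun (Γ.filterMap (LabMove.strip rightTag)) :=
  h.filterMap fun _ hΦ => hΦ.2.2

theorem ConstGame.LegalRun.disj_left {A B : ConstGame} {Γ : Run} (h : (A.disj B).LegalRun Γ) :
    A.LegalRun (Γ.filterMap (LabMove.strip leftTag)) :=
  h.filterMap fun _ hΦ => hΦ.2.1

theorem ConstGame.LegalRun.disj_right {A B : ConstGame} {Γ : Run} (h : (A.disj B).LegalRun Γ) :
    B.LegalRun (Γ.filterMap (LabMove.strip rightTag)) :=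
  h.filterMap fun _ hΦ => hΦ.2.2

/-! ### Branching recurrence -/

theorem stripThread_eq_of_dot {x : Stream' Bool} {w : List Bool} {p : Player} {α : Move} :
    (⟨p, bits w ++ .dot :: α⟩ : LabMove).stripThread x =
      if x.take w.length = w then some ⟨p, α⟩ else none := by
  split_ifs with h
  · rw [LabMove.stripThread_eq_some]
    exact ⟨w.length, by rw [h]⟩
  · rw [Option.eq_none_iff_forall_ne_some]
    intro m hm
    obtain ⟨n, hn⟩ := LabMove.stripThread_eq_some.1 hm
    obtain ⟨h₁, -⟩ := bits_append_dot_inj (LabMove.mk.inj hn).2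
    apply h
    rw [h₁, Stream'.length_take]

theorem stripThread_of_colon {x : Stream' Bool} {w : List Bool} {p : Player} :
    (⟨p, bits w ++ [.colon]⟩ : LabMove).stripThread x = none := by
  rw [Option.eq_none_iff_forall_ne_some]
  intro m hm
  obtain ⟨n, hn⟩ := LabMove.stripThread_eq_some.1 hm
  exact bits_append_dot_ne_colon (LabMove.mk.inj hn).2.symm

theorem ConstGame.brec_legal_append {A : ConstGame} {Φ : Position} {m : LabMove} :
    A.brec.Legal (Φ ++ [m]) ↔ A.brec.Legal Φ ∧ BrecLegalMove A Φ m := by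
  constructor
  · intro h
    exact ⟨A.brec.legal_of_append _ _ h, h _ _ List.prefix_rfl⟩
  · rintro ⟨h, hm⟩ Ψ m' hΨ
    rw [List.prefix_concat_iff] at hΨ
    rcases hΨ with hΨ | hΨ
    · obtain ⟨rfl, h'⟩ := List.append_inj' hΨ rfl
      rw [List.cons.injEq] at h'
      rwa [h'.1]
    · exact h _ _ hΨ

theorem ConstGame.brec_legal_thread {A : ConstGame} {Φ : Position} (h : A.brec.Legal Φ)
    (x : Stream' Bool) : A.Legal (Φ.filterMap (LabMove.stripThread x)) := by
  induction Φ using List.reverseRecOn with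
  | nil => exact A.legal_nil
  | append_singleton Φ m ih =>
    rw [ConstGame.brec_legal_append] at h
    obtain ⟨h, hm⟩ := h
    obtain ⟨p, μ⟩ := m
    rcases hm with ⟨-, w, -, rfl⟩ | ⟨w, α, -, rfl, hv⟩
    · simpa [stripThread_of_colon] using ih h
    · rw [List.filterMap_append, List.filterMap_cons, stripThread_eq_of_dot]
      split_ifs with hx
      · have := hv (x.drop w.length)
        rw [← hx, Stream'.length_take, Stream'.append_take_drop] at this
        simpa using this
      · simpa using ih h

theorem ConstGame.LegalRun.thread {A : ConstGame} {Γ : Run} (h : A.brec.LegalRun Γ)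
    (x : Stream' Bool) : A.LegalRun (Γ.filterMap (LabMove.stripThread x)) :=
  h.filterMap fun _ hΦ => ConstGame.brec_legal_thread hΦ x

/-- The node `w` becomes actual at some point of the run `Θ` of a branching recurrence. -/
def Run.IsActual (Θ : Run) (w : List Bool) : Prop := ∃ k, IsActualNode (Θ.take k) w

theorem IsActualNode.mono {Φ Ψ : Position} {w : List Bool} (h : IsActualNode Φ w)
    (hs : ∀ m ∈ Φ, m ∈ Ψ) : IsActualNode Ψ w := by
  rcases h with h | ⟨u, b, hw, m, hm, hu⟩
  · exact .inl h
  · exact .inr ⟨u, b, hw, m, hs m hm, hu⟩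

theorem ConstGame.LegalRun.has_brec {A : ConstGame} {Θ : Run} (h : A.brec.LegalRun Θ)
    {m : LabMove} (hm : Θ.Has m) :
    (m.player = .bot ∧ ∃ w, m.move = bits w ++ [.colon]) ∨
      ∃ w α, Θ.IsActual w ∧ m.move = bits w ++ .dot :: α := by
  obtain ⟨k, hk⟩ := Run.has_iff_mem_take.1 hm
  obtain ⟨s, t, hst⟩ := List.append_of_mem hk
  have hl := h k
  have hp : s ++ [m] <+: Θ.take k := ⟨t, by simp [hst]⟩
  rcases hl s m hp with ⟨hp, w, -, hw⟩ | ⟨w, α, hw, hα, -⟩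
  · exact .inl ⟨hp, w, hw⟩
  · refine .inr ⟨w, α, ⟨k, hw.mono fun m' hm' => ?_⟩, hα⟩
    rw [hst]
    exact List.mem_append_left _ hm'

/-- The replicative move that created `w` was legal, so it was made at a leaf, and the parent of `w`
was already actual. Descending from parent to parent reaches `u`. -/
theorem colon_mem_of_isActualNode {A : ConstGame} {Φ : Position} (h : A.brec.Legal Φ)
    {u w : List Bool} (hw : IsActualNode Φ w) (huw : u <+: w) (hne : u ≠ w) :
    ∃ m ∈ Φ, m.move = bits u ++ [.colon] := by
  induction hn : w.length using Nat.strong_induction_on generalizing w with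
  | _ n ih =>
    rcases hw with rfl | ⟨u', b, rfl, m, hm, hmu⟩
    · exact absurd (List.prefix_nil.1 huw) hne
    · rcases List.prefix_concat_iff.1 huw with h' | h'
      · exact absurd h' hne
      · by_cases huu : u = u'
        · subst huu
          exact ⟨m, hm, hmu⟩
        · obtain ⟨s, t, rfl⟩ := List.append_of_mem hm
          have hs := h s m ⟨t, by simp⟩
          refine ih u'.length (by simp at hn; omega) (w := u') ?_ h' huu rfl
          rcases hs with ⟨-, v, hv, hv'⟩ | ⟨v, α, -, hv, -⟩
          · rw [hmu] at hv'
            rw [bits_append_colon_inj hv']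
            exact hv.1.mono fun m hm => List.mem_append_left _ hm
          · rw [hmu] at hv
            exact absurd hv.symm bits_append_dot_ne_colon

/-- In a run of a branching recurrence where a player marks exactly the actual nodes, by moves
`mark w`, the marks seen in a thread determine the thread. -/
theorem filterMap_stripThread_eq {A : ConstGame} {Θ : Run} (hΘ : A.brec.LegalRun Θ)
    {mark : List Bool → Move} {p : Player}
    (h₁ : ∀ w, Θ.IsActual w → Θ.Has ⟨p, bits w ++ .dot :: mark w⟩)
    (h₂ : ∀ u w, Θ.Has ⟨p, bits u ++ .dot :: mark w⟩ → u = w) {x y : Stream' Bool}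
    (hxy : ∀ w, (Θ.filterMap (LabMove.stripThread x)).Has ⟨p, mark w⟩ ↔
      (Θ.filterMap (LabMove.stripThread y)).Has ⟨p, mark w⟩) :
    Θ.filterMap (LabMove.stripThread x) = Θ.filterMap (LabMove.stripThread y) := by
  -- An actual node on `x` carries its mark, which is then also seen along `y`. By `h₂` this mark
  -- occurs at its own node only, so `y` passes through that node as well.
  have key : ∀ {x y : Stream' Bool}, (∀ w, (Θ.filterMap (LabMove.stripThread x)).Has ⟨p, mark w⟩ →
      (Θ.filterMap (LabMove.stripThread y)).Has ⟨p, mark w⟩) →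
      ∀ w, Θ.IsActual w → x.take w.length = w → y.take w.length = w := by
    intro x y h w hw hx
    obtain ⟨n, hn⟩ := Run.has_filterMap_stripThread.1
      (h w (Run.has_filterMap_stripThread.2 ⟨w.length, by rw [hx]; exact h₁ w hw⟩))
    have := h₂ _ _ hn
    rw [← this, Stream'.length_take]
  -- Legality places every non-replicative move at a node that becomes actual, so agreement of `x`
  -- and `y` on such nodes is enough.
  apply Run.filterMap_congr
  rintro ⟨q, μ⟩ hm
  rcases hΘ.has_brec hm with ⟨-, w, rfl⟩ | ⟨w, α, hw, rfl⟩
  · rw [stripThread_of_colon, stripThread_of_colon]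
  · rw [stripThread_eq_of_dot, stripThread_eq_of_dot]
    have : x.take w.length = w ↔ y.take w.length = w :=
      ⟨key (fun w => (hxy w).1) w hw, key (fun w => (hxy w).2) w hw⟩
    simp only [this]

/-! ### Legality of further moves -/

theorem leftTag_not_prefix_rightTag (α β : Move) : leftTag ++ α ≠ rightTag ++ β := by
  simp [leftTag, rightTag]

theorem strip_append (pre : Move) (p : Player) (α : Move) :
    (⟨p, pre ++ α⟩ : LabMove).strip pre = some ⟨p, α⟩ :=
  LabMove.strip_eq_some.2 rfl

theorem strip_right_left (p : Player) (α : Move) :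
    (⟨p, leftTag ++ α⟩ : LabMove).strip rightTag = none := by
  rw [Option.eq_none_iff_forall_ne_some]
  intro m hm
  exact leftTag_not_prefix_rightTag _ _ (LabMove.mk.inj (LabMove.strip_eq_some.1 hm)).2

theorem strip_left_right (p : Player) (α : Move) :
    (⟨p, rightTag ++ α⟩ : LabMove).strip leftTag = none := by
  rw [Option.eq_none_iff_forall_ne_some]
  intro m hm
  exact leftTag_not_prefix_rightTag _ _ (LabMove.mk.inj (LabMove.strip_eq_some.1 hm)).2.symm

theorem ParLegal.append_left {A B : ConstGame} {Φ : Position} (h : ParLegal A B Φ) {p : Player}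
    {α : Move} (hα : A.Legal (Φ.filterMap (LabMove.strip leftTag) ++ [⟨p, α⟩])) :
    ParLegal A B (Φ ++ [⟨p, leftTag ++ α⟩]) := by
  refine ⟨?_, ?_, ?_⟩
  · intro m hm
    rcases List.mem_append.1 hm with hm | hm
    · exact h.1 m hm
    · rw [List.mem_singleton.1 hm]
      exact .inl (List.prefix_append _ _)
  · simpa [strip_append] using hα
  · simpa [strip_right_left] using h.2.2

theorem ParLegal.append_right {A B : ConstGame} {Φ : Position} (h : ParLegal A B Φ) {p : Player}
    {α : Move} (hα : B.Legal (Φ.filterMap (LabMove.strip rightTag) ++ [⟨p, α⟩])) :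
    ParLegal A B (Φ ++ [⟨p, rightTag ++ α⟩]) := by
  refine ⟨?_, ?_, ?_⟩
  · intro m hm
    rcases List.mem_append.1 hm with hm | hm
    · exact h.1 m hm
    · rw [List.mem_singleton.1 hm]
      exact .inr (List.prefix_append _ _)
  · simpa [strip_left_right] using h.2.1
  · simpa [strip_append] using hα

theorem ConstGame.neg_legal_append {A : ConstGame} {Φ : Position} {p : Player} {α : Move} :
    A.neg.Legal (Φ ++ [⟨p, α⟩]) ↔ A.Legal (Φ.map LabMove.neg ++ [⟨p.neg, α⟩]) := by
  change A.Legal _ ↔ _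
  rw [List.map_append]
  rfl

theorem ConstGame.brec_legal_append_of_actual {A : ConstGame} {Φ : Position} {p : Player}
    {w : List Bool} {α : Move} (h : A.brec.Legal Φ) (hw : IsActualNode Φ w)
    (hα : ∀ Ψ, A.Legal Ψ → A.Legal (Ψ ++ [⟨p, α⟩])) :
    A.brec.Legal (Φ ++ [⟨p, bits w ++ .dot :: α⟩]) :=
  ConstGame.brec_legal_append.2
    ⟨h, .inr ⟨w, α, hw, rfl, fun v => hα _ (ConstGame.brec_legal_thread h (w ++ₛ v))⟩⟩

/-- An actual node that has not been split is a leaf, since a proper actual extension would require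
the split. -/
theorem ConstGame.brec_legal_append_colon {A : ConstGame} {Φ : Position} {w : List Bool}
    (h : A.brec.Legal Φ) (hw : IsActualNode Φ w) (hc : ∀ m ∈ Φ, m.move ≠ bits w ++ [.colon]) :
    A.brec.Legal (Φ ++ [⟨.bot, bits w ++ [.colon]⟩]) := by
  refine ConstGame.brec_legal_append.2 ⟨h, .inl ⟨rfl, w, ⟨hw, fun w' hw' hp => ?_⟩, rfl⟩⟩
  by_contra hne
  obtain ⟨m, hm, hm'⟩ := colon_mem_of_isActualNode h hw' hp (Ne.symm hne)
  exact hc m hm hm'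

/-! ### Enumeration games -/

/-- The sets of numbers enumerated by the two players in a run. -/
def Run.value (Γ : Run) : Set ℕ × Set ℕ := (Γ.enumerated .top, Γ.enumerated .bot)

open Classical in
/-- The enumeration game in which the machine has to reach one of the values in `T`. -/
noncomputable def enumGame (T : Set (Set ℕ × Set ℕ)) : ConstGame :=
  .ofLegal (fun Φ => ∀ m ∈ Φ, ∃ n, m.move = decimal n) (by simp)
    (fun _ _ h m hm => h m (List.mem_append_left _ hm))
    fun Γ => if Γ.value ∈ T then .top else .bot

open Classical in
theorem enumGame_wn_eq_top {T : Set (Set ℕ × Set ℕ)} {Γ : Run} (h : (enumGame T).LegalRun Γ) :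
    (enumGame T).Wn Γ = .top ↔ Γ.value ∈ T :=
  (ConstGame.ofLegal_wn h).congr_left.trans ite_top_eq_top

theorem enumGame_legal_append {T : Set (Set ℕ × Set ℕ)} {Φ : Position} (h : (enumGame T).Legal Φ)
    (p : Player) (n : ℕ) : (enumGame T).Legal (Φ ++ [⟨p, decimal n⟩]) := by
  intro m hm
  rcases List.mem_append.1 hm with hm | hm
  · exact h m hm
  · rw [List.mem_singleton.1 hm]
    exact ⟨n, rfl⟩

theorem isEnumeration_enumGame (T : Set (Set ℕ × Set ℕ)) : (enumGame T).IsEnumeration := by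
  refine ⟨fun Φ => Iff.rfl, fun Γ Δ hΓ hΔ h => ?_⟩
  have hv : Γ.value = Δ.value := by rw [Run.value, Run.value, h, h]
  have := (enumGame_wn_eq_top hΓ).trans (hv ▸ (enumGame_wn_eq_top hΔ).symm)
  cases h₁ : (enumGame T).Wn Γ <;> cases h₂ : (enumGame T).Wn Δ <;> simp_all

/-! ### Enumeration games are static -/

/-- The index of a move among those of `p` is the number of earlier moves of `p`; this links
`Run.movesOf` to `Run.IsNthMoveOf`. -/
theorem getElem?_filterMap_player {p : Player} {l : Position} {n : ℕ} {m : LabMove} :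
    (l.filterMap fun m => if m.player = p then some m else none)[n]? = some m ↔
      ∃ i, l[i]? = some m ∧ m.player = p ∧ (l.take i).countP (fun m => m.player = p) = n := by
  induction l generalizing n with
  | nil => simp
  | cons a l ih =>
    by_cases ha : a.player = p
    · rw [List.filterMap_cons, if_pos ha]
      cases n with
      | zero =>
        constructor
        · intro h
          obtain rfl : a = m := by simpa using h
          exact ⟨0, by simp, ha, by simp⟩
        · rintro ⟨i, h₁, h₂, h₃⟩
          cases i with
          | zero => simpa using h₁
          | succ i => simp [ha] at h₃
      | succ n =>
        simp only [List.getElem?_cons_succ]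
        rw [ih]
        constructor
        · rintro ⟨i, h₁, h₂, h₃⟩
          exact ⟨i + 1, by simpa using h₁, h₂, by simp [ha, h₃]⟩
        · rintro ⟨i, h₁, h₂, h₃⟩
          cases i with
          | zero => simp at h₃
          | succ i => exact ⟨i, by simpa using h₁, h₂, by simpa [ha] using h₃⟩
    · rw [List.filterMap_cons, if_neg ha]
      simp only
      rw [ih]
      constructor
      · rintro ⟨i, h₁, h₂, h₃⟩
        exact ⟨i + 1, by simpa using h₁, h₂, by simp [ha, h₃]⟩
      · rintro ⟨i, h₁, h₂, h₃⟩
        cases i with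
        | zero =>
          obtain rfl : a = m := by simpa using h₁
          exact absurd h₂ ha
        | succ i => exact ⟨i, by simpa using h₁, h₂, by simpa [ha] using h₃⟩

theorem Run.get?_movesOf {p : Player} {Γ : Run} {n : ℕ} {m : LabMove} :
    (Γ.movesOf p).get? n = some m ↔
      ∃ i, Γ.get? i = some m ∧ m.player = p ∧ Γ.IsNthMoveOf p n i := by
  rw [Run.movesOf, Run.filterMap, Run.get?_limit (isGrowing_filterMap_take _ Γ)]
  simp only [getElem?_filterMap_player, Stream'.Seq.getElem?_take]
  have htake : ∀ {i k : ℕ}, i < k → (Γ.take k).take i = Γ.take i := by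
    intro i k hik
    apply List.ext_getElem?
    intro j
    rw [List.getElem?_take, Stream'.Seq.getElem?_take, Stream'.Seq.getElem?_take]
    split_ifs <;> first | rfl | omega
  constructor
  · rintro ⟨k, i, h₁, rfl, h₃⟩
    split_ifs at h₁ with hik
    rw [htake hik] at h₃
    exact ⟨i, h₁, rfl, ⟨m.move, h₁⟩, h₃⟩
  · rintro ⟨i, h₁, h₂, -, h₃⟩
    exact ⟨i + 1, i, by rw [if_pos (by omega), h₁], h₂, by rwa [htake (by omega)]⟩

theorem Run.exists_get?_movesOf {Γ : Run} {i : ℕ} {m : LabMove} (h : Γ.get? i = some m) :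
    ∃ n, (Γ.movesOf m.player).get? n = some m ∧ Γ.IsNthMoveOf m.player n i :=
  ⟨_, Run.get?_movesOf.2 ⟨i, h, rfl, ⟨m.move, h⟩, rfl⟩, ⟨m.move, h⟩, rfl⟩

theorem IsDelay.has_iff {p : Player} {Γ Δ : Run} (h : IsDelay p Γ Δ) {m : LabMove} :
    Γ.Has m ↔ Δ.Has m := by
  have key : ∀ {Γ Δ : Run}, (∀ q, Γ.movesOf q = Δ.movesOf q) → Γ.Has m → Δ.Has m := by
    rintro Γ Δ h ⟨i, hi⟩
    obtain ⟨n, hn, -⟩ := Run.exists_get?_movesOf hi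
    rw [h] at hn
    obtain ⟨j, hj, -⟩ := Run.get?_movesOf.1 hn
    exact ⟨j, hj⟩
  exact ⟨key h.1, key fun q => (h.1 q).symm⟩

theorem enumGame_legalRun_iff {T : Set (Set ℕ × Set ℕ)} {Γ : Run} :
    (enumGame T).LegalRun Γ ↔ ∀ m, Γ.Has m → ∃ n, m.move = decimal n := by
  simp only [Run.has_iff_mem_take]
  exact ⟨fun h m ⟨k, hk⟩ => h k m hk, fun h k m hm => h m ⟨k, hm⟩⟩

theorem Run.take_succ_of_get? {Γ : Run} {i : ℕ} {m : LabMove} (h : Γ.get? i = some m) :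
    Γ.HasPrefix (Γ.take i ++ [m]) := by
  have hlen : (Γ.take i).length = i := by
    apply le_antisymm Stream'.Seq.length_take_le
    by_contra hlt
    have h₁ := List.getElem?_eq_none (l := Γ.take i) (le_refl _)
    rw [Stream'.Seq.getElem?_take, if_pos (by omega)] at h₁
    have := Γ.le_stable (m := (Γ.take i).length) (n := i) (by omega) h₁
    rw [this] at h
    cases h
  unfold Run.HasPrefix
  rw [List.length_append, hlen, List.length_singleton]
  apply List.ext_getElem?
  intro j
  rw [Stream'.Seq.getElem?_take]
  rcases lt_trichotomy j i with hj | rfl | hj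
  · rw [if_pos (by omega), List.getElem?_append_left (by omega), Stream'.Seq.getElem?_take,
      if_pos hj]
  · rw [if_pos (by omega), List.getElem?_append_right (by omega), h]
    simp [hlen]
  · rw [if_neg (by omega), List.getElem?_eq_none (by simp; omega)]

/-- The first bad move of an illegal run of an enumeration game decides the winner. -/
theorem exists_first_bad {T : Set (Set ℕ × Set ℕ)} {Γ : Run} (h : ¬ (enumGame T).LegalRun Γ) :
    ∃ i m, Γ.get? i = some m ∧ (¬ ∃ n, m.move = decimal n) ∧
      (∀ j < i, ∀ m', Γ.get? j = some m' → ∃ n, m'.move = decimal n) ∧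
      (enumGame T).Wn Γ = m.player.neg := by
  classical
  have hex : ∃ i m, Γ.get? i = some m ∧ ¬ ∃ n, m.move = decimal n := by
    rw [enumGame_legalRun_iff] at h
    push Not at h
    obtain ⟨m, ⟨i, hi⟩, hm⟩ := h
    exact ⟨i, m, hi, by push Not; exact hm⟩
  obtain ⟨m, hm, hbad⟩ := Nat.find_spec hex
  have hmin : ∀ j < Nat.find hex, ∀ m', Γ.get? j = some m' → ∃ n, m'.move = decimal n := by
    intro j hj m' hm'
    by_contra hb
    exact Nat.find_min hex hj ⟨m', hm', hb⟩
  refine ⟨Nat.find hex, m, hm, hbad, hmin, ?_⟩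
  refine (enumGame T).wn_of_illegal Γ _ m (Run.take_succ_of_get? hm) ?_ fun hl => ?_
  · intro m' hm'
    obtain ⟨j, hj, hj'⟩ := Run.mem_take.1 hm'
    exact hmin j hj m' hj'
  · exact hbad (hl m (by simp))

/-- A delay has the same moves, so legal runs keep their value. For illegal runs, the first bad move
decides: if the adversary of `p` errs first in `Γ`, delaying the moves of `p` cannot make `p` err
first. -/
theorem static_enumGame (T : Set (Set ℕ × Set ℕ)) : (enumGame T).Static := by
  intro p Γ Δ h hΓ
  by_cases hl : (enumGame T).LegalRun Γ
  · have hl' : (enumGame T).LegalRun Δ := by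
      rw [enumGame_legalRun_iff] at hl ⊢
      exact fun m hm => hl m (h.has_iff.2 hm)
    rw [← hΓ]
    refine ((isEnumeration_enumGame T).2 Γ Δ hl hl' fun q => ?_).symm
    ext n
    exact h.has_iff
  · have hl' : ¬ (enumGame T).LegalRun Δ := by
      rw [enumGame_legalRun_iff] at hl ⊢
      exact fun hd => hl fun m hm => hd m (h.has_iff.1 hm)
    obtain ⟨j, m, hj, hbad, hmin, hwn⟩ := exists_first_bad hl
    obtain ⟨i', m', hi', hbad', hmin', hwn'⟩ := exists_first_bad hl'
    rw [hwn']
    by_contra hne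
    have hm : m.player = p.neg := by rw [← hΓ, hwn, Player.neg_neg]
    have hm' : m'.player = p := by
      revert hne; cases m'.player <;> cases p <;> simp [Player.neg]
    obtain ⟨n, hn, hn'⟩ := Run.exists_get?_movesOf hi'
    obtain ⟨k, hk, hk'⟩ := Run.exists_get?_movesOf hj
    rw [← h.1, Run.get?_movesOf] at hn
    rw [h.1, Run.get?_movesOf] at hk
    obtain ⟨i, hi, -, hin⟩ := hn
    obtain ⟨j', hj'', -, hjk⟩ := hk
    rw [hm'] at hn' hin
    rw [hm] at hk' hjk
    -- The bad move of `p` in `Δ` also occurs in `Γ`, at `i`, necessarily after the adversary's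
    -- first bad move at `j`. The delay preserves this order, which contradicts the minimality of
    -- `i'`.
    have hji : j < i := by
      rcases lt_trichotomy j i with hlt | rfl | hlt
      · exact hlt
      · rw [hi] at hj
        obtain rfl := Option.some.inj hj
        rw [hm'] at hm
        cases p <;> cases hm
      · exact absurd (hmin i hlt m' hi) hbad'
    have := h.2 n k i j hin hk' hji i' j' hn' hjk
    exact hbad (hmin' j' this m hj'')

/-! ### A persistent environment -/

theorem Run.has_of_hasPrefix {Γ : Run} {Φ : Position} (h : Γ.HasPrefix Φ) {m : LabMove}
    (hm : m ∈ Φ) : Γ.Has m := by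
  rw [← h] at hm
  exact Run.has_iff_mem_take.2 ⟨_, hm⟩

open Classical in
/-- The computation branch of `H` where, in step `i`, the environment makes the move `cand i`
whenever it is legal in `A`. -/
noncomputable def HPM.playAgainst (H : HPM) (e : Valuation) (A : ConstGame) (cand : ℕ → Move) :
    ℕ → H.Config
  | 0 => H.init
  | i + 1 =>
    let C := H.playAgainst e A cand i
    H.next e C (if A.Legal (C.position ++ C.machineMove ++ [⟨.bot, cand i⟩]) then [cand i] else [])

/-- Against every machine, the environment can make all moves from a countable supply that stay
legal long enough, without ever making another or an illegal move. -/
theorem exists_persistent_run (H : HPM) (e : Valuation) (A : ConstGame) {K : Type*} [Countable K]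
    [Nonempty K] (mv : K → Move) :
    ∃ Γ, H.Generates e Γ ∧ (IllegalBy A.Legal .top Γ ∨
      (A.LegalRun Γ ∧ (∀ α, Γ.Has ⟨.bot, α⟩ → ∃ k, α = mv k) ∧
        ∀ k j, (∀ Φ, Γ.HasPrefix Φ → Γ.take j <+: Φ → A.Legal Φ →
          A.Legal (Φ ++ [⟨.bot, mv k⟩])) → Γ.Has ⟨.bot, mv k⟩)) := by
  classical
  obtain ⟨s, hs⟩ := exists_surjective_nat K
  -- Through the first unpairing component every move of the supply is a candidate at arbitrarily
  -- late steps, so a move that becomes legal late is still tried.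
  set cand : ℕ → Move := fun i => mv (s i.unpair.1) with hcand
  set C := H.playAgainst e A cand with hC
  have hstep : ∀ i, (C (i + 1)).position = (C i).position ++ (C i).machineMove ++
      if A.Legal ((C i).position ++ (C i).machineMove ++ [⟨.bot, cand i⟩])
        then [⟨.bot, cand i⟩] else [] := by
    intro i
    change (C i).position ++ (C i).machineMove ++ List.map _ _ = _
    congr 1
    split_ifs <;> rfl
  have hmid : ∀ i, (C i).position ++ (C i).machineMove <+: (C (i + 1)).position :=
    fun i => ⟨_, (hstep i).symm⟩
  have hR : IsGrowing fun i => (C i).position :=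
    isGrowing_of_succ fun i => (List.prefix_append _ _).trans (hmid i)
  refine ⟨Run.limit fun i => (C i).position, ⟨C, ⟨rfl, fun i => ⟨_, rfl⟩⟩, rfl⟩, ?_⟩
  by_cases hl : ∀ i, A.Legal (C i).position
  · right
    refine ⟨fun k => ?_, fun α hα => ?_, fun k j h => ?_⟩
    · obtain ⟨j, hj⟩ := Run.take_limit_prefix hR k
      exact A.legal_of_prefix hj (hl j)
    · obtain ⟨i, hi⟩ := (Run.has_limit hR).1 hα
      induction i with
      | zero => cases hi
      | succ i ih =>
        simp only [hstep, List.mem_append] at hi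
        rcases hi with (hi | hi) | hi
        · exact ih hi
        · unfold HPM.Config.machineMove at hi
          split_ifs at hi <;> simp at hi
        · split_ifs at hi
          · exact ⟨_, (LabMove.mk.inj (List.mem_singleton.1 hi)).2⟩
          · cases hi
    · obtain ⟨i₀, hi₀⟩ := Run.take_limit_prefix hR j
      obtain ⟨c, rfl⟩ := hs k
      -- Step `Nat.pair c i₀` tries `mv (s c)` and is late enough for the position to extend `Γ.take
      -- j`.
      have hge : i₀ ≤ Nat.pair c i₀ := Nat.right_le_pair c i₀
      have hc : cand (Nat.pair c i₀) = mv (s c) := by simp [hcand]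
      have hlegal := h _ ((Run.hasPrefix_limit hR (Nat.pair c i₀ + 1)).of_prefix (hmid _))
        ((hi₀.trans (hR _ _ hge)).trans (List.prefix_append _ _))
        (A.legal_of_prefix (hmid _) (hl _))
      refine (Run.has_limit hR).2 ⟨Nat.pair c i₀ + 1, ?_⟩
      rw [← hc] at hlegal ⊢
      simp only [hstep, if_pos hlegal]
      simp
  · left
    have hex : ∃ i, ¬ A.Legal (C i).position := not_forall.1 hl
    obtain ⟨i, hi, hmin⟩ : ∃ i, ¬ A.Legal (C (i + 1)).position ∧ A.Legal (C i).position := by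
      have hf := Nat.find_spec hex
      have hm : ∀ j < Nat.find hex, A.Legal (C j).position :=
        fun j hj => not_not.1 (Nat.find_min hex hj)
      cases hn : Nat.find hex with
      | zero => rw [hn] at hf; exact absurd A.legal_nil hf
      | succ i => rw [hn] at hf hm; exact ⟨i, hf, hm i (by omega)⟩
    -- The environment moves only after checking legality, so the position was already spoilt by the
    -- machine's own move.
    have hbad : ¬ A.Legal ((C i).position ++ (C i).machineMove) := by
      intro h
      apply hi
      rw [hstep]
      split_ifs with h'
      · exact h'
      · simpa using h
    have hp := (Run.hasPrefix_limit hR (i + 1)).of_prefix (hmid i)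
    unfold HPM.Config.machineMove at hbad hp
    split_ifs at hbad hp
    · exact ⟨_, _, hp, hmin, hbad⟩
    · rw [List.append_nil] at hbad
      exact absurd hmin hbad

/-! ### Reachability -/

/-- For each `n` only countably many points are reached in exactly `n` steps. -/
theorem countable_reflTransGen {V : Type*} {s : V → V → Prop} (h : ∀ a, {b | s a b}.Countable)
    (a : V) : {b | Relation.ReflTransGen s a b}.Countable := by
  let L : ℕ → Set V := fun n => Nat.rec {a} (fun _ S => ⋃ c ∈ S, {b | s c b}) n
  have hL : ∀ n, (L n).Countable := by
    intro n
    induction n with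
    | zero => exact Set.countable_singleton a
    | succ n ih => exact ih.biUnion fun c _ => h c
  refine (Set.countable_iUnion hL).mono fun b hb => ?_
  induction hb with
  | refl => exact Set.mem_iUnion.2 ⟨0, rfl⟩
  | tail _ hbc ih =>
    obtain ⟨n, hn⟩ := Set.mem_iUnion.1 ih
    exact Set.mem_iUnion.2 ⟨n + 1, Set.mem_iUnion₂.2 ⟨_, hn, hbc⟩⟩

theorem countable_image_fiber {X V W : Type*} {g : X → V} {f : X → W}
    (h : ∀ x y, g x = g y → f x = f y) (a : V) : {b | ∃ x, g x = a ∧ b = f x}.Countable := by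
  apply Set.Subsingleton.countable
  rintro _ ⟨x, hx, rfl⟩ _ ⟨y, hy, rfl⟩
  exact h x y (hx.trans hy.symm)

theorem uncountable_streams : Uncountable (Stream' Bool) := by
  change Uncountable (ℕ → Bool)
  rw [← Cardinal.aleph0_lt_mk_iff]
  simpa using Cardinal.cantor Cardinal.aleph0

/-! ### The long production game -/

/-- The game `A → A ∧ A`. -/
noncomputable def dupGame (A : ConstGame) : ConstGame := A.neg.disj (A.conj A)

/-- The game `A ∨ A → A`. -/
noncomputable def mergeGame (A : ConstGame) : ConstGame := (A.disj A).neg.disj A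

/-- The antecedent of long production. -/
noncomputable def resourceGame (A : ConstGame) : ConstGame :=
  (A.conj (dupGame A).brec).conj (mergeGame A).brec

/-- The value of the long production formula. -/
noncomputable def productionGame (A : ConstGame) : ConstGame :=
  (resourceGame A).neg.disj A.brec

/-- The play in the antecedent of long production, with the environment as the machine. -/
noncomputable def resourceRun (Γ : Run) : Run :=
  (Γ.filterMap (LabMove.strip leftTag)).map LabMove.neg

/-- The play in the first conjunct `A` of the antecedent. -/
noncomputable def baseRun (Γ : Run) : Run :=
  ((resourceRun Γ).filterMap (LabMove.strip leftTag)).filterMap (LabMove.strip leftTag)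

/-- The play in the recurrence of `A → A ∧ A`. -/
noncomputable def dupRun (Γ : Run) : Run :=
  ((resourceRun Γ).filterMap (LabMove.strip leftTag)).filterMap (LabMove.strip rightTag)

/-- The play in the recurrence of `A ∨ A → A`. -/
noncomputable def mergeRun (Γ : Run) : Run :=
  (resourceRun Γ).filterMap (LabMove.strip rightTag)

/-- The play in the succedent. -/
noncomputable def targetRun (Γ : Run) : Run := Γ.filterMap (LabMove.strip rightTag)

/-- `resourceRun` for positions. -/
def resourcePos (Φ : Position) : Position :=
  (Φ.filterMap (LabMove.strip leftTag)).map LabMove.neg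

/-- `dupRun` for positions. -/
def dupPos (Φ : Position) : Position :=
  ((resourcePos Φ).filterMap (LabMove.strip leftTag)).filterMap (LabMove.strip rightTag)

/-- `mergeRun` for positions. -/
def mergePos (Φ : Position) : Position :=
  (resourcePos Φ).filterMap (LabMove.strip rightTag)

theorem has_dupRun {Γ : Run} {m : LabMove} :
    (dupRun Γ).Has m ↔ Γ.Has ⟨m.player.neg, leftTag ++ (leftTag ++ (rightTag ++ m.move))⟩ := by
  simp only [dupRun, resourceRun, Run.has_filterMap_strip, Run.has_map_neg, LabMove.neg]

theorem has_mergeRun {Γ : Run} {m : LabMove} :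
    (mergeRun Γ).Has m ↔ Γ.Has ⟨m.player.neg, leftTag ++ (rightTag ++ m.move)⟩ := by
  simp only [mergeRun, resourceRun, Run.has_filterMap_strip, Run.has_map_neg, LabMove.neg]

theorem has_targetRun {Γ : Run} {m : LabMove} :
    (targetRun Γ).Has m ↔ Γ.Has ⟨m.player, rightTag ++ m.move⟩ :=
  Run.has_filterMap_strip

theorem mem_dupPos {Φ : Position} {m : LabMove} : m ∈ dupPos Φ ↔
    (⟨m.player.neg, leftTag ++ (leftTag ++ (rightTag ++ m.move))⟩ : LabMove) ∈ Φ := by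
  simp only [dupPos, resourcePos, mem_filterMap_strip, mem_map_neg, LabMove.neg]

theorem mem_mergePos {Φ : Position} {m : LabMove} : m ∈ mergePos Φ ↔
    (⟨m.player.neg, leftTag ++ (rightTag ++ m.move)⟩ : LabMove) ∈ Φ := by
  simp only [mergePos, resourcePos, mem_filterMap_strip, mem_map_neg, LabMove.neg]

/-- One replicative move witnesses that a nonempty node is actual. Once its source has appeared in
`Γ`, it is seen by the projection `π` of every later position; this supplies the stage from which a
mark stays legal. -/
theorem Run.IsActual.exists_take {Θ Γ : Run} {π : Position → Position} {w : List Bool}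
    (hw : Θ.IsActual w) (h : ∀ m, Θ.Has m → ∃ m', Γ.Has m' ∧ ∀ Φ, m' ∈ Φ → m ∈ π Φ) :
    ∃ j, ∀ Φ, Γ.take j <+: Φ → IsActualNode (π Φ) w := by
  obtain ⟨k, rfl | ⟨u, b, rfl, m, hm, hu⟩⟩ := hw
  · exact ⟨0, fun _ _ => .inl rfl⟩
  · obtain ⟨m', hm', hπ⟩ := h m (Run.has_iff_mem_take.2 ⟨k, hm⟩)
    obtain ⟨j, hj⟩ := Run.has_iff_mem_take.1 hm'
    exact ⟨j, fun Φ hΦ => .inr ⟨u, b, rfl, m, hπ Φ (hΦ.subset hj), hu⟩⟩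

/-- The number by which the environment marks the node `w`. -/
def markMove (w : List Bool) : Move := decimal (Encodable.encode w)

theorem markMove_injective : Function.Injective markMove :=
  decimal_injective.comp Encodable.encode_injective

/-- The moves of the environment against long production: splitting the thread `w` of the
succedent, and marking the node `w` in each of the three recurrences. -/
def envMove : Fin 5 × List Bool → Move
  | (0, w) => rightTag ++ (bits w ++ [.colon])
  | (1, w) => rightTag ++ (bits w ++ .dot :: markMove w)
  | (2, w) => leftTag ++ (leftTag ++ (rightTag ++ (bits w ++ .dot :: (leftTag ++ markMove w))))
  | (3, w) => leftTag ++ (rightTag ++ (bits w ++ .dot :: (leftTag ++ (leftTag ++ markMove w))))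
  | (4, w) => leftTag ++ (rightTag ++ (bits w ++ .dot :: (leftTag ++ (rightTag ++ markMove w))))

/-! ### Legality of the environment's moves and unique readability of its marks -/

variable {T : Set (Set ℕ × Set ℕ)} {Φ : Position} {w : List Bool}

theorem productionGame_legal_split (h : (productionGame (enumGame T)).Legal Φ)
    (hw : IsActualNode (Φ.filterMap (LabMove.strip rightTag)) w)
    (hc : ∀ m ∈ Φ.filterMap (LabMove.strip rightTag), m.move ≠ bits w ++ [.colon]) :
    (productionGame (enumGame T)).Legal (Φ ++ [⟨.bot, envMove (0, w)⟩]) :=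
  ParLegal.append_right h (ConstGame.brec_legal_append_colon h.2.2 hw hc)

theorem productionGame_legal_target (h : (productionGame (enumGame T)).Legal Φ)
    (hw : IsActualNode (Φ.filterMap (LabMove.strip rightTag)) w) :
    (productionGame (enumGame T)).Legal (Φ ++ [⟨.bot, envMove (1, w)⟩]) :=
  ParLegal.append_right h (ConstGame.brec_legal_append_of_actual h.2.2 hw
    fun _ hΨ => enumGame_legal_append hΨ _ _)

theorem productionGame_legal_dup (h : (productionGame (enumGame T)).Legal Φ)
    (hw : IsActualNode (dupPos Φ) w) :
    (productionGame (enumGame T)).Legal (Φ ++ [⟨.bot, envMove (2, w)⟩]) := by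
  have h₁ : ParLegal ((enumGame T).conj (dupGame (enumGame T)).brec)
    (mergeGame (enumGame T)).brec (resourcePos Φ) := h.2.1
  have h₂ : ParLegal (enumGame T) (dupGame (enumGame T)).brec
    ((resourcePos Φ).filterMap (LabMove.strip leftTag)) := h₁.2.1
  exact ParLegal.append_left h (ConstGame.neg_legal_append.2 (ParLegal.append_left h₁
    (ParLegal.append_right h₂ (ConstGame.brec_legal_append_of_actual h₂.2.2 hw fun Ψ hΨ =>
      ParLegal.append_left hΨ (ConstGame.neg_legal_append.2
        (enumGame_legal_append hΨ.2.1 _ _))))))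

theorem productionGame_legal_merge (h : (productionGame (enumGame T)).Legal Φ)
    (hw : IsActualNode (mergePos Φ) w) :
    (productionGame (enumGame T)).Legal (Φ ++ [⟨.bot, envMove (3, w)⟩]) ∧
      (productionGame (enumGame T)).Legal (Φ ++ [⟨.bot, envMove (4, w)⟩]) := by
  have h₁ : ParLegal ((enumGame T).conj (dupGame (enumGame T)).brec)
    (mergeGame (enumGame T)).brec (resourcePos Φ) := h.2.1
  constructor
  · exact ParLegal.append_left h (ConstGame.neg_legal_append.2 (ParLegal.append_right h₁
      (ConstGame.brec_legal_append_of_actual h₁.2.2 hw fun Ψ hΨ =>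
        ParLegal.append_left hΨ (ConstGame.neg_legal_append.2
          (ParLegal.append_left hΨ.2.1 (enumGame_legal_append hΨ.2.1.2.1 _ _))))))
  · exact ParLegal.append_left h (ConstGame.neg_legal_append.2 (ParLegal.append_right h₁
      (ConstGame.brec_legal_append_of_actual h₁.2.2 hw fun Ψ hΨ =>
        ParLegal.append_left hΨ (ConstGame.neg_legal_append.2
          (ParLegal.append_right hΨ.2.1 (enumGame_legal_append hΨ.2.1.2.2 _ _))))))

/-- The tags keep the five families of moves apart, and node and mark can both be decoded. This
version separates the threads of the succedent; its three analogues provide the hypothesis `h₂` of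
`filterMap_stripThread_eq`. -/
theorem eq_of_envMove_target {u : List Bool} {k : Fin 5 × List Bool}
    (h : rightTag ++ (bits u ++ .dot :: markMove w) = envMove k) : u = w := by
  obtain ⟨i, w'⟩ := k
  fin_cases i
  · exact absurd (List.append_cancel_left h) bits_append_dot_ne_colon
  · obtain ⟨h₁, h₂⟩ := bits_append_dot_inj (List.append_cancel_left h)
    rw [h₁, markMove_injective h₂]
  all_goals exact absurd h.symm (leftTag_not_prefix_rightTag _ _)

theorem eq_of_envMove_dup {u : List Bool} {k : Fin 5 × List Bool}
    (h : leftTag ++ (leftTag ++ (rightTag ++ (bits u ++ .dot :: (leftTag ++ markMove w)))) =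
      envMove k) : u = w := by
  obtain ⟨i, w'⟩ := k
  fin_cases i
  · exact absurd h (leftTag_not_prefix_rightTag _ _)
  · exact absurd h (leftTag_not_prefix_rightTag _ _)
  · obtain ⟨h₁, h₂⟩ := bits_append_dot_inj
      (List.append_cancel_left (List.append_cancel_left (List.append_cancel_left h)))
    rw [h₁, markMove_injective (List.append_cancel_left h₂)]
  all_goals exact absurd (List.append_cancel_left h) (leftTag_not_prefix_rightTag _ _)

theorem eq_of_envMove_merge_left {u : List Bool} {k : Fin 5 × List Bool}
    (h : leftTag ++ (rightTag ++ (bits u ++ .dot :: (leftTag ++ (leftTag ++ markMove w)))) =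
      envMove k) : u = w := by
  obtain ⟨i, w'⟩ := k
  fin_cases i
  · exact absurd h (leftTag_not_prefix_rightTag _ _)
  · exact absurd h (leftTag_not_prefix_rightTag _ _)
  · exact absurd (List.append_cancel_left h).symm (leftTag_not_prefix_rightTag _ _)
  all_goals
    obtain ⟨h₁, h₂⟩ := bits_append_dot_inj (List.append_cancel_left (List.append_cancel_left h))
    have h₃ := List.append_cancel_left h₂
  · rw [h₁, markMove_injective (List.append_cancel_left h₃)]
  · exact absurd h₃ (leftTag_not_prefix_rightTag _ _)

theorem eq_of_envMove_merge_right {u : List Bool} {k : Fin 5 × List Bool}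
    (h : leftTag ++ (rightTag ++ (bits u ++ .dot :: (leftTag ++ (rightTag ++ markMove w)))) =
      envMove k) : u = w := by
  obtain ⟨i, w'⟩ := k
  fin_cases i
  · exact absurd h (leftTag_not_prefix_rightTag _ _)
  · exact absurd h (leftTag_not_prefix_rightTag _ _)
  · exact absurd (List.append_cancel_left h).symm (leftTag_not_prefix_rightTag _ _)
  all_goals
    obtain ⟨h₁, h₂⟩ := bits_append_dot_inj (List.append_cancel_left (List.append_cancel_left h))
    have h₃ := List.append_cancel_left h₂
  · exact absurd h₃.symm (leftTag_not_prefix_rightTag _ _)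
  · rw [h₁, markMove_injective (List.append_cancel_left h₃)]

/-! ### The persistent environment defeats long production -/

/-- A run of long production where the environment has made the moves `envMove k` whenever they
were legal long enough, and no others. -/
structure Run.IsPersistent (Γ : Run) : Prop where
  legal : ∀ T, (productionGame (enumGame T)).LegalRun Γ
  exists_eq : ∀ α, Γ.Has ⟨.bot, α⟩ → ∃ k, α = envMove k
  persistent : ∀ k j, (∀ Φ, Γ.HasPrefix Φ → Γ.take j <+: Φ →
    (productionGame (enumGame ∅)).Legal Φ →
    (productionGame (enumGame ∅)).Legal (Φ ++ [⟨.bot, envMove k⟩])) → Γ.Has ⟨.bot, envMove k⟩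

theorem Run.IsPersistent.legal_resource {Γ : Run} (hΓ : Γ.IsPersistent)
    (T : Set (Set ℕ × Set ℕ)) : (resourceGame (enumGame T)).LegalRun (resourceRun Γ) :=
  (hΓ.legal T).disj_left.neg

theorem Run.IsPersistent.legal_dup {Γ : Run} (hΓ : Γ.IsPersistent) (T : Set (Set ℕ × Set ℕ)) :
    (dupGame (enumGame T)).brec.LegalRun (dupRun Γ) :=
  (hΓ.legal_resource T).conj_left.conj_right

theorem Run.IsPersistent.legal_merge {Γ : Run} (hΓ : Γ.IsPersistent) (T : Set (Set ℕ × Set ℕ)) :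
    (mergeGame (enumGame T)).brec.LegalRun (mergeRun Γ) :=
  (hΓ.legal_resource T).conj_right

theorem Run.IsPersistent.has_dup_mark {Γ : Run} (hΓ : Γ.IsPersistent) {w : List Bool}
    (hw : (dupRun Γ).IsActual w) :
    (dupRun Γ).Has ⟨.top, bits w ++ .dot :: (leftTag ++ markMove w)⟩ := by
  obtain ⟨j, hj⟩ := hw.exists_take (Γ := Γ) (π := dupPos) fun m hm =>
    ⟨_, has_dupRun.1 hm, fun Φ hΦ => mem_dupPos.2 hΦ⟩
  exact has_dupRun.2 (hΓ.persistent (2, w) j fun Φ _ hp hl =>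
    productionGame_legal_dup hl (hj Φ hp))

theorem Run.IsPersistent.has_merge_mark {Γ : Run} (hΓ : Γ.IsPersistent) {w : List Bool}
    (hw : (mergeRun Γ).IsActual w) :
    (mergeRun Γ).Has ⟨.top, bits w ++ .dot :: (leftTag ++ (leftTag ++ markMove w))⟩ ∧
      (mergeRun Γ).Has ⟨.top, bits w ++ .dot :: (leftTag ++ (rightTag ++ markMove w))⟩ := by
  obtain ⟨j, hj⟩ := hw.exists_take (Γ := Γ) (π := mergePos) fun m hm =>
    ⟨_, has_mergeRun.1 hm, fun Φ hΦ => mem_mergePos.2 hΦ⟩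
  exact ⟨has_mergeRun.2 (hΓ.persistent (3, w) j fun Φ _ hp hl =>
      (productionGame_legal_merge hl (hj Φ hp)).1),
    has_mergeRun.2 (hΓ.persistent (4, w) j fun Φ _ hp hl =>
      (productionGame_legal_merge hl (hj Φ hp)).2)⟩

theorem exists_take_target {Γ : Run} {w : List Bool} (hw : (targetRun Γ).IsActual w) :
    ∃ j, ∀ Φ, Γ.take j <+: Φ → IsActualNode (Φ.filterMap (LabMove.strip rightTag)) w :=
  hw.exists_take fun _ hm => ⟨_, has_targetRun.1 hm, fun _ hΦ => mem_filterMap_strip.2 hΦ⟩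

theorem Run.IsPersistent.isActual_target {Γ : Run} (hΓ : Γ.IsPersistent) (w : List Bool) :
    (targetRun Γ).IsActual w := by
  induction w using List.reverseRecOn with
  | nil => exact ⟨0, .inl rfl⟩
  | append_singleton w b ih =>
    have hc : ∃ m, (targetRun Γ).Has m ∧ m.move = bits w ++ [.colon] := by
      -- If `w` were never split, its split would be legal from stage `j` on, and persistence would
      -- force the environment to make it.
      by_contra hn
      obtain ⟨j, hj⟩ := exists_take_target ih
      refine hn ⟨⟨.bot, _⟩, has_targetRun.2 (hΓ.persistent (0, w) j fun Φ hΦ hp hl =>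
        productionGame_legal_split hl (hj Φ hp) fun m hm hm' => hn ⟨m, ?_, hm'⟩), rfl⟩
      exact has_targetRun.2 (Run.has_of_hasPrefix hΦ (mem_filterMap_strip.1 hm))
    obtain ⟨m, hm, hm'⟩ := hc
    obtain ⟨k, hk⟩ := Run.has_iff_mem_take.1 hm
    exact ⟨k, .inr ⟨w, b, rfl, m, hk, hm'⟩⟩

theorem Run.IsPersistent.has_target_mark {Γ : Run} (hΓ : Γ.IsPersistent) (w : List Bool) :
    (targetRun Γ).Has ⟨.bot, bits w ++ .dot :: markMove w⟩ := by
  obtain ⟨j, hj⟩ := exists_take_target (hΓ.isActual_target w)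
  exact has_targetRun.2 (hΓ.persistent (1, w) j fun Φ _ hp hl =>
    productionGame_legal_target hl (hj Φ hp))

/-- The play in the thread `x` of the recurrence of `A → A ∧ A`. -/
noncomputable def dupThread (Γ : Run) (x : Stream' Bool) : Run :=
  (dupRun Γ).filterMap (LabMove.stripThread x)

/-- The play in the antecedent of `A → A ∧ A`. -/
noncomputable def dupIn (Γ : Run) (x : Stream' Bool) : Run :=
  ((dupThread Γ x).filterMap (LabMove.strip leftTag)).map LabMove.neg

/-- The play in the conjunct of `A → A ∧ A` with the given tag. -/
noncomputable def dupOut (tag : Move) (Γ : Run) (x : Stream' Bool) : Run :=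
  ((dupThread Γ x).filterMap (LabMove.strip rightTag)).filterMap (LabMove.strip tag)

/-- The play in the thread `x` of the recurrence of `A ∨ A → A`. -/
noncomputable def mergeThread (Γ : Run) (x : Stream' Bool) : Run :=
  (mergeRun Γ).filterMap (LabMove.stripThread x)

/-- The play in the disjunct of `A ∨ A → A` with the given tag. -/
noncomputable def mergeIn (tag : Move) (Γ : Run) (x : Stream' Bool) : Run :=
  Run.filterMap (LabMove.strip tag)
    (((mergeThread Γ x).filterMap (LabMove.strip leftTag)).map LabMove.neg)

/-- The play in the succedent of `A ∨ A → A`. -/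
noncomputable def mergeOut (Γ : Run) (x : Stream' Bool) : Run :=
  (mergeThread Γ x).filterMap (LabMove.strip rightTag)

/-- The play in the thread `v` of the succedent. -/
noncomputable def targetThread (Γ : Run) (v : Stream' Bool) : Run :=
  (targetRun Γ).filterMap (LabMove.stripThread v)

/-! ### Marks separate threads -/

theorem has_mark_iff_of_value_eq {Γ Δ : Run} (h : Γ.value = Δ.value) (w : List Bool) :
    Γ.Has ⟨.bot, markMove w⟩ ↔ Δ.Has ⟨.bot, markMove w⟩ :=
  Set.ext_iff.1 (congrArg Prod.snd h) (Encodable.encode w)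

theorem has_dupIn {Γ : Run} {x : Stream' Bool} {m : LabMove} :
    (dupIn Γ x).Has m ↔ (dupThread Γ x).Has ⟨m.player.neg, leftTag ++ m.move⟩ := by
  simp only [dupIn, Run.has_map_neg, Run.has_filterMap_strip, LabMove.neg]

theorem has_mergeIn {tag : Move} {Γ : Run} {x : Stream' Bool} {m : LabMove} :
    (mergeIn tag Γ x).Has m ↔
      (mergeThread Γ x).Has ⟨m.player.neg, leftTag ++ (tag ++ m.move)⟩ := by
  simp only [mergeIn, Run.has_map_neg, Run.has_filterMap_strip, LabMove.neg]

theorem Run.IsPersistent.dupThread_eq {Γ : Run} (hΓ : Γ.IsPersistent) {x y : Stream' Bool}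
    (h : (dupIn Γ x).value = (dupIn Γ y).value) :
    dupThread Γ x = dupThread Γ y := by
  refine filterMap_stripThread_eq (hΓ.legal_dup ∅) (mark := fun w => leftTag ++ markMove w)
    (p := .top) (fun w hw => hΓ.has_dup_mark hw) (fun u w hu => ?_) fun w => ?_
  · obtain ⟨k, hk⟩ := hΓ.exists_eq _ (has_dupRun.1 hu)
    exact eq_of_envMove_dup hk
  · exact has_dupIn.symm.trans ((has_mark_iff_of_value_eq h w).trans has_dupIn)

theorem Run.IsPersistent.mergeThread_eq_of_left {Γ : Run} (hΓ : Γ.IsPersistent) {x y : Stream' Bool}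
    (h : (mergeIn leftTag Γ x).value = (mergeIn leftTag Γ y).value) :
    mergeThread Γ x = mergeThread Γ y := by
  refine filterMap_stripThread_eq (hΓ.legal_merge ∅)
    (mark := fun w => leftTag ++ (leftTag ++ markMove w)) (p := .top)
    (fun w hw => (hΓ.has_merge_mark hw).1) (fun u w hu => ?_) fun w => ?_
  · obtain ⟨k, hk⟩ := hΓ.exists_eq _ (has_mergeRun.1 hu)
    exact eq_of_envMove_merge_left hk
  · exact has_mergeIn.symm.trans ((has_mark_iff_of_value_eq h w).trans has_mergeIn)

theorem Run.IsPersistent.mergeThread_eq_of_right {Γ : Run} (hΓ : Γ.IsPersistent)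
    {x y : Stream' Bool} (h : (mergeIn rightTag Γ x).value = (mergeIn rightTag Γ y).value) :
    mergeThread Γ x = mergeThread Γ y := by
  refine filterMap_stripThread_eq (hΓ.legal_merge ∅)
    (mark := fun w => leftTag ++ (rightTag ++ markMove w)) (p := .top)
    (fun w hw => (hΓ.has_merge_mark hw).2) (fun u w hu => ?_) fun w => ?_
  · obtain ⟨k, hk⟩ := hΓ.exists_eq _ (has_mergeRun.1 hu)
    exact eq_of_envMove_merge_right hk
  · exact has_mergeIn.symm.trans ((has_mark_iff_of_value_eq h w).trans has_mergeIn)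

/-- All nodes of the succedent become actual and are marked, so the value in a thread records all
initial segments of that thread. -/
theorem Run.IsPersistent.targetThread_value_injective {Γ : Run} (hΓ : Γ.IsPersistent) :
    Function.Injective fun v => (targetThread Γ v).value := by
  intro x y h
  apply Stream'.take_theorem
  intro n
  have h₁ : (targetThread Γ x).Has ⟨.bot, markMove (x.take n)⟩ :=
    Run.has_filterMap_stripThread.2 ⟨n, hΓ.has_target_mark (x.take n)⟩
  obtain ⟨k, hk⟩ := Run.has_filterMap_stripThread.1 ((has_mark_iff_of_value_eq h _).1 h₁)
  obtain ⟨c, hc⟩ := hΓ.exists_eq _ (has_targetRun.1 hk)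
  -- The mark of `x.take n` seen along `y` sits at a node `y.take k`, which must be `x.take n`;
  -- comparing lengths gives `k = n`.
  have he := eq_of_envMove_target hc
  have hlen := congrArg List.length he
  rw [Stream'.length_take, Stream'.length_take] at hlen
  rw [← he, hlen]

/-! ### Forced values and the outcome of the run -/

/-- One step in the propagation of the values that the environment has to win: `a` is the value
of the input and `b` that of an output in a thread of a recurrence in the antecedent. -/
def ValueStep (Γ : Run) (a b : Set ℕ × Set ℕ) : Prop :=
  ((∃ x, (dupIn Γ x).value = a ∧ b = (dupOut leftTag Γ x).value) ∨
    ∃ x, (dupIn Γ x).value = a ∧ b = (dupOut rightTag Γ x).value) ∨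
  (∃ x, (mergeIn leftTag Γ x).value = a ∧ b = (mergeOut Γ x).value) ∨
    ∃ x, (mergeIn rightTag Γ x).value = a ∧ b = (mergeOut Γ x).value

/-- The values that the environment has to win. -/
def reachable (Γ : Run) : Set (Set ℕ × Set ℕ) :=
  {b | Relation.ReflTransGen (ValueStep Γ) (baseRun Γ).value b}

/-- Although there are uncountably many threads, those with the same input value carry the same
play. Each of the four kinds of step thus leads from a value to at most one other. -/
theorem Run.IsPersistent.countable_reachable {Γ : Run} (hΓ : Γ.IsPersistent) :
    (reachable Γ).Countable := by
  refine countable_reflTransGen (fun a => ?_) _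
  refine ((countable_image_fiber ?_ a).union (countable_image_fiber ?_ a)).union
    ((countable_image_fiber ?_ a).union (countable_image_fiber ?_ a))
  · intro x y h
    rw [dupOut, dupOut, hΓ.dupThread_eq h]
  · intro x y h
    rw [dupOut, dupOut, hΓ.dupThread_eq h]
  · intro x y h
    rw [mergeOut, mergeOut, hΓ.mergeThread_eq_of_left h]
  · intro x y h
    rw [mergeOut, mergeOut, hΓ.mergeThread_eq_of_right h]

theorem Run.IsPersistent.exists_value_notMem {Γ : Run} (hΓ : Γ.IsPersistent) :
    ∃ v, (targetThread Γ v).value ∉ reachable Γ := by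
  by_contra! h
  have := uncountable_streams
  have hc := hΓ.countable_reachable.to_subtype
  have : Countable (Stream' Bool) :=
    Function.Injective.countable (f := fun v => (⟨_, h v⟩ : reachable Γ)) fun x y hxy =>
      hΓ.targetThread_value_injective (Subtype.ext_iff.1 hxy)
  exact not_countable this

/-- In a thread of `A → A ∧ A`, either the input is outside `T` and `¬A` is won, or both outputs are
in `T`. In a thread of `A ∨ A → A`, either the output is in `T`, or neither input is. -/
theorem Run.IsPersistent.resource_wn {Γ : Run} (hΓ : Γ.IsPersistent) :
    (resourceGame (enumGame (reachable Γ))).Wn (resourceRun Γ) = .top := by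
  set T := reachable Γ with hT
  have hr := hΓ.legal_resource T
  rw [resourceGame, ConstGame.conj_wn_eq_top hr, ConstGame.conj_wn_eq_top hr.conj_left]
  refine ⟨⟨?_, ?_⟩, ?_⟩
  · exact (enumGame_wn_eq_top hr.conj_left.conj_left).2 Relation.ReflTransGen.refl
  · refine (ConstGame.brec_wn_eq_top (hΓ.legal_dup T)).2 fun x => ?_
    have hx := (hΓ.legal_dup T).thread x
    refine (ConstGame.disj_wn_eq_top hx).2 ?_
    by_cases hin : (dupIn Γ x).value ∈ T
    · right
      refine (ConstGame.conj_wn_eq_top hx.disj_right).2 ⟨?_, ?_⟩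
      · exact (enumGame_wn_eq_top hx.disj_right.conj_left).2
          (hin.tail (.inl (.inl ⟨x, rfl, rfl⟩)))
      · exact (enumGame_wn_eq_top hx.disj_right.conj_right).2
          (hin.tail (.inl (.inr ⟨x, rfl, rfl⟩)))
    · left
      refine (ConstGame.neg_wn_eq_top hx.disj_left).2 fun h => hin ?_
      exact (enumGame_wn_eq_top hx.disj_left.neg).1 h
  · refine (ConstGame.brec_wn_eq_top (hΓ.legal_merge T)).2 fun x => ?_
    have hx := (hΓ.legal_merge T).thread x
    refine (ConstGame.disj_wn_eq_top hx).2 ?_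
    by_cases hout : (mergeOut Γ x).value ∈ T
    · right
      exact (enumGame_wn_eq_top hx.disj_right).2 hout
    · left
      refine (ConstGame.neg_wn_eq_top hx.disj_left).2 fun h => hout ?_
      have hn := hx.disj_left.neg
      rcases (ConstGame.disj_wn_eq_top hn).1 h with h | h
      · have hin : (mergeIn leftTag Γ x).value ∈ T := (enumGame_wn_eq_top hn.disj_left).1 h
        exact hin.tail (.inr (.inl ⟨x, rfl, rfl⟩))
      · have hin : (mergeIn rightTag Γ x).value ∈ T := (enumGame_wn_eq_top hn.disj_right).1 h
        exact hin.tail (.inr (.inr ⟨x, rfl, rfl⟩))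

theorem Run.IsPersistent.production_wn {Γ : Run} (hΓ : Γ.IsPersistent) :
    (productionGame (enumGame (reachable Γ))).Wn Γ = .bot := by
  have hl := hΓ.legal (reachable Γ)
  refine Player.ne_top.1 fun h => ?_
  rcases (ConstGame.disj_wn_eq_top hl).1 h with h | h
  · exact (ConstGame.neg_wn_eq_top hl.disj_left).1 h hΓ.resource_wn
  · obtain ⟨v, hv⟩ := hΓ.exists_value_notMem
    exact hv ((enumGame_wn_eq_top (hl.disj_right.thread v)).1
      ((ConstGame.brec_wn_eq_top hl.disj_right).1 h v))

theorem exists_enumGame_production_lost (H : HPM) (e : Valuation) :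
    ∃ T Γ, H.Generates e Γ ∧ (productionGame (enumGame T)).Wn Γ = .bot := by
  obtain ⟨Γ, hΓ, ⟨Φ, α, h₁, h₂, h₃⟩ | ⟨h₁, h₂, h₃⟩⟩ :=
    exists_persistent_run H e (productionGame (enumGame ∅)) envMove
  · exact ⟨∅, Γ, hΓ, (productionGame (enumGame ∅)).wn_of_illegal Γ Φ _ h₁ h₂ h₃⟩
  -- The run was produced for the winning set `∅`, but legality does not mention this set, so `h₁`
  -- serves definitionally for every `T`.
  · exact ⟨reachable Γ, Γ, hΓ, Run.IsPersistent.production_wn ⟨fun _ => h₁, h₂, h₃⟩⟩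

end CoL

theorem mainTheorem5 (P : ℕ) :
    ¬ CoL.UniformlyValid (CoL.Formula.longProduction (.letter P)) ∧
    ∀ (H : CoL.HPM) (e : CoL.Valuation), ∃ A : CoL.ConstGame, A.Static ∧ A.IsEnumeration ∧
      ∃ Γ : CoL.Run, H.Generates e Γ ∧
        ((CoL.Formula.longProduction (.letter P)).interp (fun _ _ => A) e).Wn Γ =
          CoL.Player.bot := by
  have key : ∀ (H : CoL.HPM) (e : CoL.Valuation), ∃ A : CoL.ConstGame, A.Static ∧
      A.IsEnumeration ∧ ∃ Γ : CoL.Run, H.Generates e Γ ∧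
        ((CoL.Formula.longProduction (.letter P)).interp (fun _ _ => A) e).Wn Γ =
          CoL.Player.bot := by
    intro H e
    obtain ⟨T, Γ, hΓ, h⟩ := CoL.exists_enumGame_production_lost H e
    -- The interpreted formula unfolds definitionally to `productionGame`.
    exact ⟨CoL.enumGame T, CoL.static_enumGame T, CoL.isEnumeration_enumGame T, Γ, hΓ, h⟩
  refine ⟨fun ⟨H, hH⟩ => ?_, key⟩
  obtain ⟨A, hA, -, Γ, hΓ, h⟩ := key H fun _ => 0
  have := hH ⟨fun _ _ => A, fun _ _ => hA⟩ _ Γ hΓ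
  rw [h] at this
  cases this
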